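/- Let $\mathbb{B}^3=\{x\in\mathbb{R}^3:|x|<1\}$ and let $u:\mathbb{B}^3\to(-1,1)$ be a harmonic function. Let $D_r u(x)$ denote the radial derivative of $u$ at $x$, i.e. the derivative of $u$ at $x$ in the direction $x/|x|$ if $x\neq 0$; for $x=0$ it stands for the derivative of $u$ at $0$ in the direction of an arbitrary unit vector. Then, for every $x\in\mathbb{B}^3$, $$\frac{-3-|x|u(x)}{1-|x|^2}\cdot\frac{1-u(x)^2}{2}\;\le\; D_r u(x)\;\le\;\frac{3-|x|u(x)}{1-|x|^2}\cdot\frac{1-u(x)^2}{2}$$ and $$|\nabla u(x)|\;\le\; 2\,\frac{1-u(x)^2}{1-|x|^2}.$$ Moreover, for $n\ge 1$ let $d_{h_n}$ denote the hyperbolic (Poincaré) distance of the open unit ball $\mathbb{B}^n\subset\mathbb{R}^n$, i.e. the infimum of the lengths $\int_0^1 \frac{2|\gamma'(t)|}{1-|\gamma(t)|^2}\,dt$ over all $C^1$ curves $\gamma:[0,1]\to\mathbb{B}^n$ joining the two given points. Then, for all $x_1,x_2\in\mathbb{B}^3$, $$d_{h_1}(u(x_1),u(x_2))\le 2\,d_{h_3}(x_1,x_2)\qquad\text{and}\qquad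 d_{h_2}(u(x_1),u(x_2))\le 2\,d_{h_3}(x_1,x_2),$$ where for $d_{h_1}$ the values of $u$ are points of $(-1,1)=\mathbb{B}^1$, and for $d_{h_2}$ the interval $(-1,1)$ is identified with $(-1,1)\times\{0\}\subset\mathbb{B}^2$. -/

import Mathlib

open Set Metric InnerProductSpace

noncomputable section

/-- `γ : [0, 1] → E` is a continuously differentiable curve from `x` to `y` that stays in the open
unit ball of `E`. Values of `γ` outside `[0, 1]` are irrelevant. -/
structure IsBallCurve {E : Type*} [NormedAddCommGroup E] [InnerProductSpace ℝ E]
    (γ : ℝ → E) (x y : E) : Prop where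
  contDiffOn : ContDiffOn ℝ 1 γ (Icc 0 1)
  mem_ball : ∀ t ∈ Icc (0 : ℝ) 1, γ t ∈ ball (0 : E) 1
  source : γ 0 = x
  target : γ 1 = y

/-- The hyperbolic length of a curve `γ : [0, 1] → E` in the unit ball, i.e. its length with
respect to the Riemannian metric `2 |dx| / (1 - |x|²)` of curvature `-1`. -/
def hyperbolicLength {E : Type*} [NormedAddCommGroup E] [InnerProductSpace ℝ E]
    (γ : ℝ → E) : ℝ :=
  ∫ t in (0 : ℝ)..1, 2 * ‖derivWithin γ (Icc 0 1) t‖ / (1 - ‖γ t‖ ^ 2)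

/-- The hyperbolic (Poincaré) distance of the open unit ball of `E`: the infimum of the hyperbolic
lengths of the continuously differentiable curves in the ball that join the two points. For
`E = ℝ` the ball is the interval `(-1, 1)`. -/
def hyperbolicDist {E : Type*} [NormedAddCommGroup E] [InnerProductSpace ℝ E] (x y : E) : ℝ :=
  sInf {L : ℝ | ∃ γ : ℝ → E, IsBallCurve γ x y ∧ L = hyperbolicLength γ}

end

section

open MeasureTheory Filter Topology
open scoped Pointwise

/-! The argument is a duality bound. If `W` is harmonic in the unit ball and `|W| ≤ k` there, then
`W 0` and the gradient of `W` at `0` are spherical means of `W` against `1` and against linear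
functions. Hence any combination of them is at most the mean of `k` times the absolute value of an
affine function (`affine_center_le_sphereMean`).

To reach a point `x ≠ 0`, let `p = x / |x|²` and take the Kelvin transform `W y = |y - p|⁻¹ u(y*)`,
where `y ↦ y*` is the inversion centred at `p` that preserves the unit ball and exchanges `0` and
`x`. Then `W` is harmonic, `|W y| ≤ |y - p|⁻¹`, and the value and gradient of `W` at `0` encode
those of `u` at `x`. On the unit sphere `|p| |η - p|⁻¹ = |x - η|⁻¹`, so `affine_le_integral_abs`
bounds `A u(x) + (B/3)((1 - |x|²) ∂ₑu(x) - ⟨x,e⟩ u(x))` by the spherical mean of `|A - B⟨e,η⟩| |x -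
η|⁻¹`, for all real `A`, `B`. The nonlinear dependence on `u(x)` in the theorem comes from letting
`A` depend on `u(x)`.

In the radial direction the integrand depends on the height `⟨e,η⟩` alone, which is uniformly
distributed on `[-1, 1]` (Archimedes). With the optimal `A` the integral is computed exactly, and
the sharp bound results.

For a general direction take `B = 3` and `A = 4u(x) + ⟨x,e⟩`. The gradient bound then follows from
the estimate `(16 + l²)/8`, with `l = 4u(x)`, for a weighted first absolute moment
(`integral_abs_le`). It is proved in three regimes: by second moments for small `|l|`; otherwise,
after the reduction to `l ≥ 0`, through the positive part of the affine function, with a parabolic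
majorant if `⟨x,e⟩ ≥ 0` and a lower bound for `|x - η|` if `⟨x,e⟩ < 0`.

Finally, the gradient bound says that `u` expands the infinitesimal hyperbolic metric by a factor of
at most `2`. Integration along curves gives both distance estimates. -/

/-- Euclidean three-space. -/
abbrev E3 : Type := EuclideanSpace ℝ (Fin 3)

/-! ### Spherical means, polar coordinates and rotation invariance -/

/-- The uniform probability measure on the unit sphere of `E3`, as a measure on `E3`. -/
noncomputable def sphereMean : Measure E3 :=
  ((volume : Measure E3).toSphere univ)⁻¹ • ((volume : Measure E3).toSphere).map Subtype.val

instance : IsProbabilityMeasure sphereMean := by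
  refine ⟨?_⟩
  rw [sphereMean, Measure.smul_apply, Measure.map_apply measurable_subtype_coe .univ, preimage_univ,
    smul_eq_mul]
  exact ENNReal.inv_mul_cancel (Measure.measure_univ_ne_zero.2 (Measure.toSphere_ne_zero _))
    (measure_ne_top _ _)

theorem measurableEmbedding_sphere_coe :
    MeasurableEmbedding (Subtype.val : sphere (0 : E3) 1 → E3) :=
  MeasurableEmbedding.subtype_coe isClosed_sphere.measurableSet

theorem ae_norm_eq_one : ∀ᵐ η ∂sphereMean, ‖η‖ = 1 := by
  refine Measure.ae_smul_measure ?_ _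
  rw [measurableEmbedding_sphere_coe.ae_map_iff]
  exact Eventually.of_forall fun η => by simp

theorem integral_sphereMean (F : E3 → ℝ) :
    ∫ η, F η ∂sphereMean = ((volume : Measure E3).toSphere.real univ)⁻¹ *
      ∫ η, F η.1 ∂(volume : Measure E3).toSphere := by
  rw [sphereMean, integral_smul_measure, measurableEmbedding_sphere_coe.integral_map]
  simp only [ENNReal.toReal_inv, smul_eq_mul]
  rfl

theorem toSphere_real_pos : 0 < (volume : Measure E3).toSphere.real univ := by
  rw [Measure.real, ENNReal.toReal_pos_iff]
  exact ⟨pos_iff_ne_zero.2 (Measure.measure_univ_ne_zero.2 (Measure.toSphere_ne_zero _)), measure_lt_top _ _⟩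

theorem integrable_sphereMean {F : E3 → ℝ} (hF : ContinuousOn F (sphere 0 1)) :
    Integrable F sphereMean := by
  have h : Integrable F (sphereMean.restrict (sphere 0 1)) :=
    hF.integrableOn_compact (isCompact_sphere 0 1)
  rwa [Measure.restrict_eq_self_of_ae_mem] at h
  filter_upwards [ae_norm_eq_one] with η hη
  simpa using hη

theorem integral_polar {f : E3 → ℝ} (hf : Integrable f) :
    ∫ y, f y = (volume : Measure E3).toSphere.real univ *
      ∫ s in Ioi (0 : ℝ), s ^ 2 * ∫ η, f (s • η) ∂sphereMean := by
  have hmp := (volume : Measure E3).measurePreserving_homeomorphUnitSphereProd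
  have hemb := (homeomorphUnitSphereProd E3).measurableEmbedding
  have hdim : Module.finrank ℝ E3 - 1 = 2 := by simp
  rw [hdim] at hmp
  set g : sphere (0 : E3) 1 × Ioi (0 : ℝ) → ℝ := fun q => f (q.2.1 • q.1.1) with hg
  have hgf : ∀ y : ({0}ᶜ : Set E3), g (homeomorphUnitSphereProd E3 y) = f y := by
    intro y
    have := congrArg Subtype.val ((homeomorphUnitSphereProd E3).symm_apply_apply y)
    simp only [homeomorphUnitSphereProd_symm_apply_coe] at this
    simp only [hg, this]
  have h1 : ∫ y, f y = ∫ y : ({0}ᶜ : Set E3), f y ∂(Measure.comap Subtype.val volume) := by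
    rw [integral_subtype_comap (measurableSet_singleton _).compl f, restrict_compl_singleton]
  have h2 : Integrable g ((volume : Measure E3).toSphere.prod (Measure.volumeIoiPow 2)) := by
    rw [← hmp.integrable_comp_emb hemb]
    have : g ∘ homeomorphUnitSphereProd E3 = f ∘ Subtype.val := funext hgf
    rw [this]
    have := (MeasurableEmbedding.subtype_coe (measurableSet_singleton (0 : E3)).compl).integrable_map_iff
      (g := f) (μ := Measure.comap Subtype.val (volume : Measure E3))
    rw [← this, map_comap_subtype_coe (measurableSet_singleton _).compl]
    exact hf.integrableOn
  calc ∫ y, f y = ∫ y : ({0}ᶜ : Set E3), g (homeomorphUnitSphereProd E3 y)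
        ∂(Measure.comap Subtype.val volume) := by rw [h1]; simp only [hgf]
    _ = ∫ q, g q ∂((volume : Measure E3).toSphere.prod (Measure.volumeIoiPow 2)) :=
        hmp.integral_comp hemb g
    _ = ∫ s : Ioi (0 : ℝ), ∫ η, f (s.1 • η.1) ∂(volume : Measure E3).toSphere
          ∂(Measure.volumeIoiPow 2) := integral_prod_symm g h2
    _ = ∫ s : Ioi (0 : ℝ), s.1 ^ 2 * ∫ η, f (s.1 • η.1) ∂(volume : Measure E3).toSphere
          ∂(Measure.comap Subtype.val volume) := by
        rw [Measure.volumeIoiPow, integral_withDensity_eq_integral_toReal_smul]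
        · refine integral_congr_ae (Eventually.of_forall fun s => ?_)
          have : 0 ≤ s.1 ^ 2 := sq_nonneg _
          simp [ENNReal.toReal_ofReal this]
        · fun_prop
        · exact Eventually.of_forall fun s => ENNReal.ofReal_lt_top
    _ = ∫ s in Ioi (0 : ℝ), s ^ 2 * ∫ η, f (s • η.1) ∂(volume : Measure E3).toSphere := by
        rw [integral_subtype_comap measurableSet_Ioi
          (fun s : ℝ => s ^ 2 * ∫ η, f (s • η.1) ∂(volume : Measure E3).toSphere)]
    _ = _ := by
        rw [← integral_const_mul]
        refine integral_congr_ae (Eventually.of_forall fun s => ?_)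
        simp only [integral_sphereMean (fun η => f (s • η))]
        have := toSphere_real_pos.ne'
        field_simp

/-- Up to a constant, the spherical measure of a set is the Lebesgue volume of the cone over it, and
linear isometries map cones to cones and preserve volume. -/
theorem integral_sphereMean_comp_isometry (T : E3 ≃ₗᵢ[ℝ] E3) (F : E3 → ℝ) :
    ∫ η, F (T η) ∂sphereMean = ∫ η, F η ∂sphereMean := by
  have hT : Measurable T := T.continuous.measurable
  have key : sphereMean.map T = sphereMean := by
    ext s hs
    rw [Measure.map_apply hT hs, sphereMean, Measure.smul_apply, Measure.smul_apply,
      Measure.map_apply measurable_subtype_coe (hT hs), Measure.map_apply measurable_subtype_coe hs,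
      Measure.toSphere_apply' _ (measurable_subtype_coe (hT hs)),
      Measure.toSphere_apply' _ (measurable_subtype_coe hs)]
    congr 2
    have hset : Ioo (0 : ℝ) 1 • (Subtype.val '' (Subtype.val ⁻¹' (T ⁻¹' s) : Set (sphere (0 : E3) 1)))
        = T ⁻¹' (Ioo (0 : ℝ) 1 • (Subtype.val '' (Subtype.val ⁻¹' s : Set (sphere (0 : E3) 1)))) := by
      ext y
      simp only [Set.mem_smul, mem_image, mem_preimage, Subtype.exists, mem_sphere_iff_norm, sub_zero,
        exists_and_left, exists_prop, exists_eq_right_right]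
      constructor
      · rintro ⟨a, ha, z, ⟨hz, hz1⟩, rfl⟩
        exact ⟨a, ha, T z, by simpa using ⟨hz, hz1⟩, by simp⟩
      · rintro ⟨a, ha, z, ⟨hz, hz1⟩, h⟩
        refine ⟨a, ha, T.symm z, by simpa using ⟨hz, hz1⟩, ?_⟩
        apply T.injective
        simpa using h
    rw [hset]
    exact T.measurePreserving.measure_preimage_emb T.toHomeomorph.measurableEmbedding _
  conv_rhs => rw [← key]
  exact (T.toHomeomorph.measurableEmbedding.integral_map F).symm

/-! ### Integration by parts against compactly supported weights -/

/-- Nothing is known of `g` off `U`. The weight `ψ` hides those values, so integrals over the whole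
space can be used throughout. -/
theorem continuous_mul_of_tsupport_subset {ψ g : E3 → ℝ} {U : Set E3} (hU : IsOpen U)
    (hψ : Continuous ψ) (hs : tsupport ψ ⊆ U) (hg : ContinuousOn g U) :
    Continuous fun y => ψ y * g y := by
  refine continuous_of_tsupport fun y hy => ?_
  have hyU : y ∈ U := hs (closure_mono (Function.support_mul_subset_left ψ g) hy)
  exact hψ.continuousAt.mul (hg.continuousAt (hU.mem_nhds hyU))

theorem integrable_mul_of_tsupport_subset {ψ g : E3 → ℝ} {U : Set E3} (hU : IsOpen U)
    (hψ : Continuous ψ) (hc : HasCompactSupport ψ) (hs : tsupport ψ ⊆ U) (hg : ContinuousOn g U) :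
    Integrable fun y => ψ y * g y :=
  (continuous_mul_of_tsupport_subset hU hψ hs hg).integrable_of_hasCompactSupport hc.mul_right

theorem continuousOn_fderiv_apply {g : E3 → ℝ} {U : Set E3} (hU : IsOpen U)
    (hg : ContDiffOn ℝ 1 g U) (v : E3) : ContinuousOn (fun y => fderiv ℝ g y v) U :=
  (hg.continuousOn_fderiv_of_isOpen hU le_rfl).clm_apply continuousOn_const

theorem integral_mul_fderiv_of_tsupport_subset {ψ g : E3 → ℝ} {U : Set E3} (hU : IsOpen U)
    (hψ : ContDiff ℝ 1 ψ) (hc : HasCompactSupport ψ) (hs : tsupport ψ ⊆ U)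
    (hg : ContDiffOn ℝ 1 g U) (v : E3) :
    ∫ y, ψ y * fderiv ℝ g y v = -∫ y, fderiv ℝ ψ y v * g y := by
  refine integral_mul_fderiv_eq_neg_fderiv_mul_of_integrable ?_ ?_ ?_ ?_ ?_
  · exact integrable_mul_of_tsupport_subset hU
      ((hψ.continuous_fderiv one_ne_zero).clm_apply continuous_const)
      (hc.fderiv_apply ℝ v) ((tsupport_fderiv_apply_subset ℝ v).trans hs) hg.continuousOn
  · exact integrable_mul_of_tsupport_subset hU hψ.continuous hc hs
      (continuousOn_fderiv_apply hU hg v)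
  · exact integrable_mul_of_tsupport_subset hU hψ.continuous hc hs hg.continuousOn
  · exact fun y _ => hψ.differentiable one_ne_zero y
  · exact fun y hy => (hg.contDiffAt (hU.mem_nhds (hs hy))).differentiableAt one_ne_zero

section Radial

variable {H : ℝ → ℝ} {b : ℝ}

theorem contDiff_radial (hH : ContDiff ℝ 1 H) : ContDiff ℝ 1 fun y : E3 => H (‖y‖ ^ 2) :=
  hH.comp (contDiff_norm_sq ℝ)

theorem tsupport_radial_subset (hb : ∀ t, b ^ 2 ≤ t → H t = 0) (hb0 : 0 ≤ b) :
    tsupport (fun y : E3 => H (‖y‖ ^ 2)) ⊆ closedBall 0 b := by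
  refine closure_minimal (fun y hy => ?_) isClosed_closedBall
  rw [mem_closedBall_zero_iff]
  by_contra h
  exact hy (hb _ (by gcongr; exact (not_le.1 h).le))

theorem hasCompactSupport_radial (hb : ∀ t, b ^ 2 ≤ t → H t = 0) (hb0 : 0 ≤ b) :
    HasCompactSupport (fun y : E3 => H (‖y‖ ^ 2)) :=
  (isCompact_closedBall 0 b).of_isClosed_subset (isClosed_tsupport _) (tsupport_radial_subset hb hb0)

theorem fderiv_radial (hH : ContDiff ℝ 1 H) (y v : E3) :
    fderiv ℝ (fun y : E3 => H (‖y‖ ^ 2)) y v = 2 * deriv H (‖y‖ ^ 2) * inner ℝ y v := by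
  have h1 : HasFDerivAt (fun y : E3 => ‖y‖ ^ 2) (2 • innerSL ℝ y) y :=
    (hasStrictFDerivAt_norm_sq y).hasFDerivAt
  have h2 := ((hH.differentiable one_ne_zero (‖y‖ ^ 2)).hasDerivAt).comp_hasFDerivAt y h1
  have h3 := h2.fderiv
  simp only [Function.comp_def] at h3
  rw [h3]
  simp
  ring

end Radial

theorem sum_apply_mul_single (y : E3) (f : E3 →L[ℝ] ℝ) :
    ∑ i, y i * f (EuclideanSpace.single i 1) = f y := by
  conv_rhs => rw [← (EuclideanSpace.basisFun (Fin 3) ℝ).sum_repr y]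
  simp

theorem inner_single_one (y : E3) (i : Fin 3) : inner ℝ y (EuclideanSpace.single i (1 : ℝ)) = y i := by
  simp [EuclideanSpace.inner_single_right]

/-- Green's first identity against a radial weight, for a function with vanishing Laplacian. -/
theorem integral_radial_mul_fderiv_eq_zero {w : E3 → ℝ} {U : Set E3} (hU : IsOpen U)
    (hw : ContDiffOn ℝ 2 w U)
    (hlap : ∀ y ∈ U, ∑ i, fderiv ℝ (fun z => fderiv ℝ w z (EuclideanSpace.single i 1)) y
      (EuclideanSpace.single i 1) = 0)
    {ψ : E3 → ℝ} (hψ : ContDiff ℝ 1 ψ) (hc : HasCompactSupport ψ) (hs : tsupport ψ ⊆ U) :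
    ∫ y, ∑ i, fderiv ℝ ψ y (EuclideanSpace.single i 1) * fderiv ℝ w y (EuclideanSpace.single i 1)
      = 0 := by
  have hdw (v : E3) : ContDiffOn ℝ 1 (fun z => fderiv ℝ w z v) U :=
    (hw.fderiv_of_isOpen hU (by norm_num)).clm_apply contDiffOn_const
  have hI1 (v : E3) : Integrable fun y => fderiv ℝ ψ y v * fderiv ℝ w y v :=
    integrable_mul_of_tsupport_subset hU
      ((hψ.continuous_fderiv one_ne_zero).clm_apply continuous_const)
      (hc.fderiv_apply ℝ v) ((tsupport_fderiv_apply_subset ℝ v).trans hs) (hdw v).continuousOn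
  have hI2 (v : E3) : Integrable fun y => ψ y * fderiv ℝ (fun z => fderiv ℝ w z v) y v :=
    integrable_mul_of_tsupport_subset hU hψ.continuous hc hs (continuousOn_fderiv_apply hU (hdw v) v)
  rw [integral_finsetSum _ fun i _ => hI1 _]
  have := fun i : Fin 3 => integral_mul_fderiv_of_tsupport_subset hU hψ hc hs
    (hdw (EuclideanSpace.single i 1)) (EuclideanSpace.single i 1)
  have h2 : ∑ i : Fin 3, ∫ y, ψ y * fderiv ℝ (fun z => fderiv ℝ w z (EuclideanSpace.single i 1)) y
      (EuclideanSpace.single i 1) = 0 := by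
    rw [← integral_finsetSum _ fun i _ => hI2 _]
    rw [← integral_zero E3 ℝ (μ := volume)]
    congr 1
    funext y
    rw [← Finset.mul_sum]
    by_cases hy : y ∈ tsupport ψ
    · rw [hlap y (hs hy), mul_zero]
    · rw [image_eq_zero_of_notMem_tsupport hy, zero_mul]
  rw [Finset.sum_congr rfl fun i _ => this i, Finset.sum_neg_distrib, neg_eq_zero] at h2
  exact h2

/-! ### Moments of the height function and Archimedes' theorem -/

section Moments

variable {H : ℝ → ℝ} {b : ℝ}

theorem fderiv_inner_pow (v y z : E3) (n : ℕ) :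
    fderiv ℝ (fun y : E3 => (inner ℝ v y : ℝ) ^ n) y z
      = n * (inner ℝ v y) ^ (n - 1) * inner ℝ v z := by
  have h := ((innerSL ℝ v).hasFDerivAt (x := y)).pow n
  simp only [innerSL_apply_apply] at h
  rw [h.fderiv]
  simp

/-- The vector field `|y|²⟨v,y⟩ⁿ v - ⟨v,y⟩ⁿ⁺¹ y` is tangent to the spheres about `0`, so it is
orthogonal to the gradient of a radial weight. The factor next to the weight is its divergence. -/
theorem integral_radial_moment (hH : ContDiff ℝ 1 H) (hb : ∀ t, b ^ 2 ≤ t → H t = 0) (hb0 : 0 ≤ b)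
    {v : E3} (hv : ‖v‖ = 1) (n : ℕ) :
    ∫ y : E3, H (‖y‖ ^ 2) * (n * ‖y‖ ^ 2 * (inner ℝ v y) ^ (n - 1)
      - (n + 2) * (inner ℝ v y) ^ (n + 1)) = 0 := by
  set ψ : E3 → ℝ := fun y => H (‖y‖ ^ 2) with hψdef
  have hψ : ContDiff ℝ 1 ψ := contDiff_radial hH
  have hc : HasCompactSupport ψ := hasCompactSupport_radial hb hb0
  have hint {g : E3 → ℝ} (hg : Continuous g) : Integrable fun y => ψ y * g y :=
    integrable_mul_of_tsupport_subset isOpen_univ hψ.continuous hc (subset_univ _) hg.continuousOn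
  have hint' {g : E3 → ℝ} (hg : Continuous g) (z : E3) : Integrable fun y => fderiv ℝ ψ y z * g y :=
    integrable_mul_of_tsupport_subset isOpen_univ
      ((hψ.continuous_fderiv one_ne_zero).clm_apply continuous_const)
      (hc.fderiv_apply ℝ z) (subset_univ _) hg.continuousOn
  have ibp {g : E3 → ℝ} (hg : ContDiff ℝ 1 g) (z : E3) :=
    integral_mul_fderiv_of_tsupport_subset isOpen_univ hψ hc (subset_univ _) hg.contDiffOn z
  have hin (k : ℕ) : ContDiff ℝ 1 fun y : E3 => (inner ℝ v y : ℝ) ^ k :=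
    (contDiff_const.inner ℝ contDiff_id).pow k
  have hcrd (i : Fin 3) : ContDiff ℝ 1 fun y : E3 => y i :=
    (EuclideanSpace.proj (𝕜 := ℝ) i).contDiff
  have hg1 : ContDiff ℝ 1 fun y : E3 => ‖y‖ ^ 2 * (inner ℝ v y) ^ n := (contDiff_norm_sq ℝ).mul (hin n)
  have hg2 (i : Fin 3) : ContDiff ℝ 1 fun y : E3 => (inner ℝ v y) ^ (n + 1) * y i :=
    (hin _).mul (hcrd i)
  have d1 (y : E3) : fderiv ℝ (fun y : E3 => ‖y‖ ^ 2 * (inner ℝ v y) ^ n) y v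
      = 2 * (inner ℝ v y) ^ (n + 1) + n * ‖y‖ ^ 2 * (inner ℝ v y) ^ (n - 1) := by
    have hn := fderiv_radial contDiff_id y v
    rw [fderiv_fun_mul ((contDiff_norm_sq ℝ).differentiable one_ne_zero y)
      ((hin n).differentiable one_ne_zero y)]
    simp only [id, deriv_id'] at hn
    simp only [add_apply, smul_apply, smul_eq_mul, hn,
      fderiv_inner_pow, real_inner_self_eq_norm_sq, hv, real_inner_comm v y]
    ring
  have d2 (y : E3) (i : Fin 3) : fderiv ℝ (fun y : E3 => (inner ℝ v y) ^ (n + 1) * y i) y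
      (EuclideanSpace.single i 1) = (inner ℝ v y) ^ (n + 1)
        + (n + 1) * (inner ℝ v y) ^ n * (v i * y i) := by
    have hn : fderiv ℝ (fun y : E3 => y i) y (EuclideanSpace.single i 1) = 1 := by
      have := (EuclideanSpace.proj i : E3 →L[ℝ] ℝ).hasFDerivAt (x := y)
      rw [show (fun y : E3 => y i) = (EuclideanSpace.proj (𝕜 := ℝ) i : E3 →L[ℝ] ℝ) from rfl, this.fderiv]
      simp
    rw [fderiv_fun_mul ((hin _).differentiable one_ne_zero y)
      ((hcrd i).differentiable one_ne_zero y)]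
    simp only [add_apply, smul_apply, smul_eq_mul, hn,
      fderiv_inner_pow, inner_single_one]
    push_cast
    ring
  have e1 := ibp hg1 v
  have e2 := Finset.sum_congr rfl fun (i : Fin 3) (_ : i ∈ Finset.univ) =>
    ibp (hg2 i) (EuclideanSpace.single i 1)
  simp only [d1] at e1
  simp only [d2] at e2
  have hcin : Continuous fun y : E3 => (inner ℝ v y : ℝ) := by fun_prop
  rw [← integral_finsetSum _ fun i _ => hint (by fun_prop), Finset.sum_neg_distrib,
    ← integral_finsetSum _ fun i _ => hint' (by fun_prop) _] at e2
  have e3 : ∀ y : E3, ∑ i : Fin 3, ψ y * ((inner ℝ v y) ^ (n + 1)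
        + (n + 1) * (inner ℝ v y) ^ n * (v i * y i)) = ψ y * ((n + 4) * (inner ℝ v y) ^ (n + 1)) := by
    intro y
    have : (inner ℝ v y : ℝ) = ∑ i : Fin 3, v i * y i := by
      simp [PiLp.inner_apply, mul_comm]
    rw [← Finset.mul_sum, Finset.sum_add_distrib, ← Finset.mul_sum, ← this]
    simp only [Finset.sum_const, Finset.card_univ, Fintype.card_fin, nsmul_eq_mul]
    push_cast
    ring
  have e4 : ∀ y : E3, ∑ i : Fin 3, fderiv ℝ ψ y (EuclideanSpace.single i 1) *
      ((inner ℝ v y) ^ (n + 1) * y i) = fderiv ℝ ψ y v * (‖y‖ ^ 2 * (inner ℝ v y) ^ n) := by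
    intro y
    have : ∑ i : Fin 3, fderiv ℝ ψ y (EuclideanSpace.single i 1) * ((inner ℝ v y) ^ (n + 1) * y i)
        = (inner ℝ v y) ^ (n + 1) * fderiv ℝ ψ y y := by
      rw [← sum_apply_mul_single y (fderiv ℝ ψ y), Finset.mul_sum]
      exact Finset.sum_congr rfl fun i _ => by ring
    rw [this, hψdef, fderiv_radial hH, fderiv_radial hH, real_inner_self_eq_norm_sq,
      real_inner_comm v y]
    ring
  simp only [e3, e4] at e2
  have e5 := e1.trans e2.symm
  rw [← sub_eq_zero, ← integral_sub (hint (by fun_prop)) (hint (by fun_prop))] at e5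
  rw [← e5]
  congr 1
  funext y
  ring

end Moments

theorem sphereMean_moment_recurrence {e : E3} (he : ‖e‖ = 1) (n : ℕ) :
    n * ∫ η, (inner ℝ e η) ^ (n - 1) ∂sphereMean
      = (n + 2) * ∫ η, (inner ℝ e η) ^ (n + 1) ∂sphereMean := by
  let f : ContDiffBump (0 : ℝ) := ⟨1, 2, one_pos, one_lt_two⟩
  have hf : ContDiff ℝ 1 f := f.contDiff
  have hb : ∀ t, (2 : ℝ) ^ 2 ≤ t → f t = 0 := fun t ht => f.zero_of_le_dist (by
    rw [Real.dist_eq, sub_zero]; exact le_trans (by norm_num [f]) (ht.trans (le_abs_self t)))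
  have hint {k : ℕ} : Integrable (fun η => (inner ℝ e η : ℝ) ^ k) sphereMean :=
    integrable_sphereMean (by fun_prop)
  have h0 := integral_radial_moment hf hb (by norm_num) he n
  rw [integral_polar] at h0
  · set m := n * ∫ η, (inner ℝ e η : ℝ) ^ (n - 1) ∂sphereMean
      - (n + 2) * ∫ η, (inner ℝ e η : ℝ) ^ (n + 1) ∂sphereMean with hm
    have hin : ∀ s ∈ Ioi (0 : ℝ), s ^ 2 * ∫ η, f (‖s • η‖ ^ 2) * (n * ‖s • η‖ ^ 2 *
        (inner ℝ e (s • η)) ^ (n - 1) - (n + 2) * (inner ℝ e (s • η)) ^ (n + 1)) ∂sphereMean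
        = m * (s ^ 2 * (s ^ (n + 1) * f (s ^ 2))) := by
      intro s hs
      have : ∫ η, f (‖s • η‖ ^ 2) * (n * ‖s • η‖ ^ 2 *
        (inner ℝ e (s • η)) ^ (n - 1) - (n + 2) * (inner ℝ e (s • η)) ^ (n + 1)) ∂sphereMean
        = ∫ η, (s ^ (n + 1) * f (s ^ 2)) * (n * (inner ℝ e η) ^ (n - 1)
          - (n + 2) * (inner ℝ e η) ^ (n + 1)) ∂sphereMean := by
        refine integral_congr_ae ?_
        filter_upwards [ae_norm_eq_one] with η hη
        rw [norm_smul, hη, real_inner_smul_right, mul_one, Real.norm_eq_abs, sq_abs]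
        rcases n with _ | n
        · simp; ring
        · simp only [Nat.add_sub_cancel]; ring
      rw [this, integral_const_mul, integral_sub (hint.const_mul _) (hint.const_mul _),
        integral_const_mul, integral_const_mul]
      ring
    rw [setIntegral_congr_fun measurableSet_Ioi hin, integral_const_mul] at h0
    have hpos : 0 < ∫ s in Ioi (0 : ℝ), s ^ 2 * (s ^ (n + 1) * f (s ^ 2)) := by
      have hcont : Continuous fun s : ℝ => s ^ 2 * (s ^ (n + 1) * f (s ^ 2)) := by
        have := f.continuous
        fun_prop
      have hcs : HasCompactSupport fun s : ℝ => s ^ 2 * (s ^ (n + 1) * f (s ^ 2)) := by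
        refine HasCompactSupport.of_support_subset_isCompact (isCompact_Icc (a := (-2 : ℝ)) (b := 2))
          fun s hs => ?_
        by_contra h
        refine hs ?_
        have : f (s ^ 2) = 0 := hb _ (by
          rw [← sq_abs s]
          rw [mem_Icc, ← abs_le] at h
          push Not at h
          gcongr)
        simp [this]
      rw [setIntegral_pos_iff_support_of_nonneg_ae]
      · have hsub : Ioo (0 : ℝ) 1 ⊆ Function.support (fun s : ℝ => s ^ 2 * (s ^ (n + 1) * f (s ^ 2)))
            ∩ Ioi 0 := by
          intro s hs
          refine ⟨?_, hs.1⟩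
          have h1 : 0 < f (s ^ 2) := f.pos_of_mem_ball (by
            rw [mem_ball, Real.dist_eq, sub_zero, abs_of_nonneg (sq_nonneg s)]
            have : s ^ 2 < 1 := by nlinarith [hs.1, hs.2]
            exact this.trans one_lt_two)
          have := hs.1
          exact (by positivity : 0 < s ^ 2 * (s ^ (n + 1) * f (s ^ 2))).ne'
        exact lt_of_lt_of_le (by simp) (measure_mono hsub)
      · filter_upwards [ae_restrict_mem measurableSet_Ioi] with s hs
        have h1 : 0 ≤ f (s ^ 2) := f.nonneg
        have : 0 < s := hs
        exact (by positivity : 0 ≤ s ^ 2 * (s ^ (n + 1) * f (s ^ 2)))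
      · exact (hcont.integrable_of_hasCompactSupport hcs).integrableOn
    have := toSphere_real_pos.ne'
    have hm0 : m = 0 := by
      rcases mul_eq_zero.1 h0 with h | h
      · exact absurd h this
      · exact (mul_eq_zero.1 h).resolve_right hpos.ne'
    linarith
  · refine integrable_mul_of_tsupport_subset isOpen_univ (contDiff_radial hf).continuous
      (hasCompactSupport_radial hb (by norm_num)) (subset_univ _) ?_
    fun_prop

theorem sphereMean_moment {e : E3} (he : ‖e‖ = 1) (n : ℕ) :
    ∫ η, (inner ℝ e η) ^ n ∂sphereMean = (∫ t in (-1 : ℝ)..1, t ^ n) / 2 := by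
  rw [integral_pow]
  induction n using Nat.twoStepInduction with
  | zero => simp
  -- At `n = 0` the recurrence reads `0 = 2 ∫ ⟨e,η⟩`; the truncated exponent `0 - 1` is multiplied
  -- by `0`.
  | one => have := sphereMean_moment_recurrence he 0; norm_num at this ⊢; simpa using this
  | more n ih _ =>
    have h := sphereMean_moment_recurrence he (n + 1)
    simp only [Nat.add_sub_cancel] at h
    rw [ih] at h
    push_cast at h ⊢
    have h1 : (n : ℝ) + 1 ≠ 0 := by positivity
    have h3 : (n : ℝ) + 1 + 2 ≠ 0 := by positivity
    have h3' : (n : ℝ) + 2 + 1 ≠ 0 := by positivity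
    have : ∫ η, (inner ℝ e η : ℝ) ^ (n + 1 + 1) ∂sphereMean = (1 ^ (n + 1) - (-1 : ℝ) ^ (n + 1)) / 2 / (n + 1 + 2) := by
      rw [eq_div_iff h3, mul_comm, ← h]
      field_simp
    rw [show n + 2 = n + 1 + 1 from rfl, this]
    simp only [one_pow, pow_succ]
    field_simp
    ring

/-- Archimedes: the height function on the unit sphere of `E3` is uniformly distributed. -/
theorem integral_sphereMean_inner {e : E3} (he : ‖e‖ = 1) {g : ℝ → ℝ}
    (hg : ContinuousOn g (Icc (-1) 1)) :
    ∫ η, g (inner ℝ e η) ∂sphereMean = (∫ t in (-1 : ℝ)..1, g t) / 2 := by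
  have hmem : ∀ η : E3, ‖η‖ = 1 → (inner ℝ e η : ℝ) ∈ Icc (-1 : ℝ) 1 := fun η hη => by
    have := abs_real_inner_le_norm e η
    rw [he, hη, one_mul, abs_le] at this
    exact this
  have hint {g : ℝ → ℝ} (hg : ContinuousOn g (Icc (-1) 1)) :
      Integrable (fun η => g (inner ℝ e η)) sphereMean :=
    integrable_sphereMean (hg.comp (by fun_prop) fun η hη => hmem η (by simpa using hη))
  have hint' {g : ℝ → ℝ} (hg : ContinuousOn g (Icc (-1) 1)) : IntervalIntegrable g volume (-1) 1 :=
    (hg.mono (by rw [uIcc_of_le (by norm_num)])).intervalIntegrable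
  have hpoly (p : Polynomial ℝ) :
      ∫ η, p.eval (inner ℝ e η) ∂sphereMean = (∫ t in (-1 : ℝ)..1, p.eval t) / 2 := by
    simp only [Polynomial.eval_eq_sum_range]
    rw [integral_finsetSum _ fun i _ => hint (g := fun t => p.coeff i * t ^ i) (by fun_prop),
      intervalIntegral.integral_finsetSum fun i _ =>
        hint' (g := fun t => p.coeff i * t ^ i) (by fun_prop), Finset.sum_div]
    refine Finset.sum_congr rfl fun i _ => ?_
    rw [integral_const_mul, intervalIntegral.integral_const_mul, sphereMean_moment he]
    ring
  refine eq_of_forall_dist_le fun ε hε => ?_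
  rw [Real.dist_eq]
  -- Equality of all moments gives the claim for polynomials; Weierstrass approximation extends it
  -- to continuous `g`.
  obtain ⟨p, hp⟩ := exists_polynomial_near_of_continuousOn (-1) 1 g hg (ε / 2) (by positivity)
  have hpc : ContinuousOn (fun t => p.eval t) (Icc (-1 : ℝ) 1) := p.continuous.continuousOn
  have h1 : |∫ η, g (inner ℝ e η) ∂sphereMean - ∫ η, p.eval (inner ℝ e η) ∂sphereMean| ≤ ε / 2 := by
    rw [← integral_sub (hint hg) (hint hpc), ← Real.norm_eq_abs]
    refine (norm_integral_le_of_norm_le_const (C := ε / 2) ?_).trans (by simp)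
    filter_upwards [ae_norm_eq_one] with η hη
    rw [Real.norm_eq_abs, abs_sub_comm]
    exact (hp _ (hmem η hη)).le
  have h2 : |(∫ t in (-1 : ℝ)..1, p.eval t) - ∫ t in (-1 : ℝ)..1, g t| ≤ ε := by
    rw [← intervalIntegral.integral_sub (hint' hpc) (hint' hg), ← Real.norm_eq_abs]
    refine (intervalIntegral.norm_integral_le_of_norm_le_const (C := ε / 2) fun t ht => ?_).trans
      (by norm_num)
    rw [uIoc_of_le (by norm_num)] at ht
    exact (hp t ⟨ht.1.le, ht.2⟩).le
  rw [hpoly] at h1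
  rw [abs_le] at h1 h2 ⊢
  constructor <;> linarith [h1.1, h1.2, h2.1, h2.2]

theorem integral_sphereMean_inner_sq {e : E3} (he : ‖e‖ = 1) :
    ∫ η, (inner ℝ e η) ^ 2 ∂sphereMean = 1 / 3 := by
  rw [sphereMean_moment he, integral_pow]
  norm_num

theorem integral_sphereMean_inner_self {e : E3} : ∫ η, inner ℝ e η ∂sphereMean = 0 := by
  have := integral_sphereMean_comp_isometry (LinearIsometryEquiv.neg ℝ) fun η => (inner ℝ e η : ℝ)
  simp only [LinearIsometryEquiv.coe_neg, inner_neg_right, integral_neg] at this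
  linarith

theorem integral_sphereMean_inner_sq' (a : E3) :
    ∫ η, (inner ℝ a η) ^ 2 ∂sphereMean = ‖a‖ ^ 2 / 3 := by
  by_cases ha : a = 0
  · simp [ha]
  have hn : ‖a‖ ≠ 0 := norm_ne_zero_iff.2 ha
  have h := integral_sphereMean_inner_sq (e := ‖a‖⁻¹ • a) (by simp [norm_smul, hn])
  simp only [real_inner_smul_left, mul_pow] at h
  rw [integral_const_mul] at h
  field_simp at h ⊢
  linarith

theorem integral_sphereMean_inner_mul_inner (a b : E3) :
    ∫ η, inner ℝ a η * inner ℝ b η ∂sphereMean = inner ℝ a b / 3 := by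
  have h1 := integral_sphereMean_inner_sq' (a + b)
  have h2 := integral_sphereMean_inner_sq' a
  have h3 := integral_sphereMean_inner_sq' b
  have hi {g : E3 → ℝ} (hg : Continuous g) : Integrable g sphereMean :=
    integrable_sphereMean hg.continuousOn
  have : ∀ η, (inner ℝ (a + b) η : ℝ) ^ 2
      = (inner ℝ a η) ^ 2 + 2 * (inner ℝ a η * inner ℝ b η) + (inner ℝ b η) ^ 2 := fun η => by
    rw [inner_add_left]; ring
  simp only [this] at h1
  rw [integral_add (hi (by fun_prop)) (hi (by fun_prop)),
    integral_add (hi (by fun_prop)) (hi (by fun_prop)), integral_const_mul, h2, h3,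
    norm_add_sq_real] at h1
  linarith

/-! ### Localisation to spheres and mean value formulas -/

theorem exists_bound_of_continuousOn_ball {G : E3 → ℝ} {R s : ℝ} (hG : ContinuousOn G (ball 0 R))
    (hs : s < R) : ∃ C, ∀ y ∈ closedBall (0 : E3) s, ‖G y‖ ≤ C :=
  (isCompact_closedBall 0 s).exists_bound_of_continuousOn (hG.mono (closedBall_subset_ball hs))

theorem continuousAt_sphereMean_smul {G : E3 → ℝ} {R s : ℝ} (hG : ContinuousOn G (ball 0 R))
    (hs : |s| < R) : ContinuousAt (fun s : ℝ => ∫ η, G (s • η) ∂sphereMean) s := by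
  obtain ⟨s₁, h1, h2⟩ := exists_between hs
  obtain ⟨C, hC⟩ := exists_bound_of_continuousOn_ball hG h2
  have hev : ∀ᶠ t in 𝓝 s, |t| < s₁ := continuous_abs.continuousAt.eventually (gt_mem_nhds h1)
  refine continuousAt_of_dominated (bound := fun _ => C) ?_ ?_ (integrable_const _) ?_
  · filter_upwards [hev] with t ht
    refine (integrable_sphereMean (F := fun η => G (t • η)) (hG.comp (by fun_prop)
      fun η hη => ?_)).aestronglyMeasurable
    rw [mem_sphere_zero_iff_norm] at hη
    simpa [norm_smul, hη] using ht.trans h2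
  · filter_upwards [hev] with t ht
    filter_upwards [ae_norm_eq_one] with η hη
    exact hC _ (by simpa [norm_smul, hη] using ht.le)
  · filter_upwards [ae_norm_eq_one] with η hη
    have : ContinuousAt G (s • η) := hG.continuousAt (isOpen_ball.mem_nhds
      (by simpa [norm_smul, hη] using hs))
    exact ContinuousAt.comp (f := fun t : ℝ => t • η) this (by fun_prop)

/-- Passes from identities tested on radial weights to identities on each sphere. A nonzero
spherical mean keeps its sign for nearby radii by continuity, and a bump in `|y|²` around `s²` would
detect it in polar coordinates. -/
theorem sphereMean_smul_eq_zero {G : E3 → ℝ} {R : ℝ} (hG : ContinuousOn G (ball 0 R))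
    (h : ∀ (H : ℝ → ℝ) (b : ℝ), Continuous H → 0 ≤ b → b < R → (∀ t, b ^ 2 ≤ t → H t = 0) →
      ∫ y : E3, H (‖y‖ ^ 2) * G y = 0) {s : ℝ} (hs0 : 0 < s) (hs : s < R) :
    ∫ η, G (s • η) ∂sphereMean = 0 := by
  set N : ℝ → ℝ := fun s => ∫ η, G (s • η) ∂sphereMean with hN
  change N s = 0
  by_contra hne
  have hNc : ∀ t ∈ Ioo 0 R, ContinuousAt N t := fun t ht =>
    continuousAt_sphereMean_smul hG (by rw [abs_of_pos ht.1]; exact ht.2)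
  have hpos : ∀ᶠ t in 𝓝 s, 0 < N s * N t :=
    (continuousAt_const.mul (hNc s ⟨hs0, hs⟩)).eventually
      (lt_mem_nhds (mul_self_pos.2 hne))
  obtain ⟨δ, hδ, hδN⟩ := Metric.eventually_nhds_iff.1 hpos
  set d := min (δ / 2) (min (s / 2) ((R - s) / 2)) with hd
  have hd0 : 0 < d := by
    have : 0 < R - s := sub_pos.2 hs
    positivity
  have hd1 : d < δ := lt_of_le_of_lt (min_le_left _ _) (by linarith)
  have hd2 : d < s := lt_of_le_of_lt ((min_le_right _ _).trans (min_le_left _ _)) (by linarith)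
  have hd3 : d < R - s := lt_of_le_of_lt ((min_le_right _ _).trans (min_le_right _ _)) (by linarith)
  have hr : 0 < d * s := by positivity
  -- The bump lives in the variable `t²`. Since `|t² - s²| = |t - s| (t + s) ≥ d s` once `|t - s| >
  -- d` and `t > 0`, the outer radius `d s` keeps `t` within `d` of `s`.
  let f : ContDiffBump (s ^ 2) := ⟨d * s / 2, d * s, by linarith, by linarith⟩
  have hfz : ∀ t, 0 < t → d < |t - s| → f (t ^ 2) = 0 := by
    intro t ht h
    refine f.zero_of_le_dist ?_
    rw [Real.dist_eq, show t ^ 2 - s ^ 2 = (t - s) * (t + s) by ring, abs_mul,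
      abs_of_pos (by linarith : 0 < t + s)]
    change d * s ≤ _
    gcongr
    linarith
  have hmem : ∀ t, |t - s| ≤ d → t ∈ Ioo 0 R := by
    intro t ht
    rw [abs_le] at ht
    constructor <;> linarith [ht.1, ht.2]
  have key := h f (s + d) f.continuous (by linarith) (by linarith) (fun t ht => by
    refine f.zero_of_le_dist ?_
    rw [Real.dist_eq, abs_of_nonneg (by nlinarith)]
    change d * s ≤ _
    nlinarith)
  have hsup : tsupport (fun y : E3 => f (‖y‖ ^ 2)) ⊆ closedBall 0 (s + d) :=
    tsupport_radial_subset (fun t ht => by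
      refine f.zero_of_le_dist ?_
      rw [Real.dist_eq, abs_of_nonneg (by nlinarith)]
      change d * s ≤ _
      nlinarith) (by linarith)
  have hfc := f.continuous
  rw [integral_polar (integrable_mul_of_tsupport_subset isOpen_ball (by fun_prop)
    ((isCompact_closedBall 0 (s + d)).of_isClosed_subset (isClosed_tsupport _) hsup)
    (hsup.trans (closedBall_subset_ball (by linarith))) hG)] at key
  have hin : ∀ t ∈ Ioi (0 : ℝ), t ^ 2 * ∫ η, f (‖t • η‖ ^ 2) * G (t • η) ∂sphereMean
      = t ^ 2 * (f (t ^ 2) * N t) := by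
    intro t _
    congr 1
    rw [show N t = ∫ η, G (t • η) ∂sphereMean from rfl, ← integral_const_mul]
    refine integral_congr_ae ?_
    filter_upwards [ae_norm_eq_one] with η hη
    rw [norm_smul, hη, mul_one, Real.norm_eq_abs, sq_abs]
  rw [setIntegral_congr_fun measurableSet_Ioi hin] at key
  have key2 : ∫ t in Ioi (0 : ℝ), N s * (t ^ 2 * (f (t ^ 2) * N t)) = 0 := by
    rw [integral_const_mul, (mul_eq_zero.1 key).resolve_left toSphere_real_pos.ne', mul_zero]
  have hIcc : Icc (s - d) (s + d) ⊆ Ioo 0 R := fun t ht => hmem t (by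
    rw [abs_le]; constructor <;> linarith [ht.1, ht.2])
  rw [setIntegral_eq_of_subset_of_forall_sdiff_eq_zero (s := Icc (s - d) (s + d)) measurableSet_Ioi
    (fun t ht => (hIcc ht).1) (fun t ht => by
      have : f (t ^ 2) = 0 := hfz t ht.1 (by
        by_contra hcon
        rw [not_lt, abs_le] at hcon
        exact ht.2 ⟨by linarith [hcon.1], by linarith [hcon.2]⟩)
      rw [this]; ring)] at key2
  have hcont : ContinuousOn (fun t => N s * (t ^ 2 * (f (t ^ 2) * N t))) (Icc (s - d) (s + d)) := by
    have : ContinuousOn N (Icc (s - d) (s + d)) := fun t ht =>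
      (hNc t (hIcc ht)).continuousWithinAt
    fun_prop
  have hnn : ∀ t ∈ Icc (s - d) (s + d), 0 < N s * N t := fun t ht =>
    hδN (by rw [Real.dist_eq]; exact lt_of_le_of_lt (by
      rw [abs_le]; constructor <;> linarith [ht.1, ht.2]) hd1)
  have : 0 < ∫ t in (s - d)..(s + d), N s * (t ^ 2 * (f (t ^ 2) * N t)) := by
    refine intervalIntegral.integral_pos (by linarith) hcont (fun t ht => ?_)
      ⟨s, ⟨by linarith, by linarith⟩, ?_⟩
    · have h1 := hnn t ⟨ht.1.le, ht.2⟩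
      have h2 : 0 ≤ f (t ^ 2) := f.nonneg
      rw [show N s * (t ^ 2 * (f (t ^ 2) * N t)) = t ^ 2 * f (t ^ 2) * (N s * N t) by ring]
      positivity
    · have h1 := hnn s ⟨by linarith, by linarith⟩
      have h2 : 0 < f (s ^ 2) := f.pos_of_mem_ball (mem_ball_self hr)
      rw [show N s * (s ^ 2 * (f (s ^ 2) * N s)) = s ^ 2 * f (s ^ 2) * (N s * N s) by ring]
      positivity
  rw [intervalIntegral.integral_of_le (by linarith), ← integral_Icc_eq_integral_Ioc, key2] at this
  exact this.false

section MeanValue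

variable {w : E3 → ℝ} {R : ℝ}

theorem continuousOn_fderiv_self (hw : ContDiffOn ℝ 1 w (ball 0 R)) :
    ContinuousOn (fun y => fderiv ℝ w y y) (ball 0 R) :=
  (hw.continuousOn_fderiv_of_isOpen isOpen_ball le_rfl).clm_apply continuousOn_id

/-- Integrating from `b²` makes the primitive vanish beyond `b²`. Thus every weight `h(|y|²)` occurs
in the gradient `2 h(|y|²) y` of a compactly supported radial function. -/
theorem exists_primitive_radial {h : ℝ → ℝ} {b : ℝ} (hc : Continuous h)
    (hb : ∀ t, b ^ 2 ≤ t → h t = 0) :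
    ∃ H : ℝ → ℝ, ContDiff ℝ 1 H ∧ deriv H = h ∧ ∀ t, b ^ 2 ≤ t → H t = 0 := by
  have hd : ∀ t, HasDerivAt (fun t => ∫ x in (b ^ 2)..t, h x) (h t) t := fun t =>
    intervalIntegral.integral_hasDerivAt_right (hc.intervalIntegrable _ _)
      (hc.stronglyMeasurableAtFilter _ _) hc.continuousAt
  have hder : deriv (fun t => ∫ x in (b ^ 2)..t, h x) = h := funext fun t => (hd t).deriv
  refine ⟨fun t => ∫ x in (b ^ 2)..t, h x, ?_, hder, fun t ht => ?_⟩
  · rw [contDiff_one_iff_deriv, hder]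
    exact ⟨fun t => (hd t).differentiableAt, hc⟩
  · refine (intervalIntegral.integral_congr (g := fun _ => (0 : ℝ)) ?_).trans
      intervalIntegral.integral_zero
    intro x hx
    rw [uIcc_of_le ht] at hx
    exact hb x hx.1

theorem sphereMean_fderiv_self_eq_zero (hw : ContDiffOn ℝ 2 w (ball 0 R))
    (hlap : ∀ y ∈ ball (0 : E3) R, ∑ i, fderiv ℝ (fun z => fderiv ℝ w z (EuclideanSpace.single i 1)) y
      (EuclideanSpace.single i 1) = 0) {s : ℝ} (hs0 : 0 < s) (hs : s < R) :
    ∫ η, fderiv ℝ w (s • η) (s • η) ∂sphereMean = 0 := by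
  refine sphereMean_smul_eq_zero (G := fun y => fderiv ℝ w y y)
    (continuousOn_fderiv_self (hw.of_le one_le_two)) (fun h b hc hb0 hbR hb => ?_) hs0 hs
  obtain ⟨H, hH, hHd, hHb⟩ := exists_primitive_radial hc hb
  have := integral_radial_mul_fderiv_eq_zero isOpen_ball hw hlap (contDiff_radial hH)
    (hasCompactSupport_radial hHb hb0)
    ((tsupport_radial_subset hHb hb0).trans (closedBall_subset_ball hbR))
  have hpt : ∀ y : E3, ∑ i, fderiv ℝ (fun y : E3 => H (‖y‖ ^ 2)) y (EuclideanSpace.single i 1) *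
      fderiv ℝ w y (EuclideanSpace.single i 1) = 2 * (h (‖y‖ ^ 2) * fderiv ℝ w y y) := by
    intro y
    simp only [fderiv_radial hH, inner_single_one, hHd]
    rw [← sum_apply_mul_single y (fderiv ℝ w y), Finset.mul_sum, Finset.mul_sum]
    exact Finset.sum_congr rfl fun i _ => by ring
  simp only [hpt] at this
  rw [integral_const_mul] at this
  linarith

/-- Green's second identity on a sphere for `w` and the harmonic function `⟨v,y⟩`, whose derivative
along `y` is itself. It comes from testing with `H(|y|²)⟨v,y⟩` and moving the derivative in
direction `v` from `w` to the radial factor. -/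
theorem sphereMean_inner_mul_fderiv_self (hw : ContDiffOn ℝ 2 w (ball 0 R))
    (hlap : ∀ y ∈ ball (0 : E3) R, ∑ i, fderiv ℝ (fun z => fderiv ℝ w z (EuclideanSpace.single i 1)) y
      (EuclideanSpace.single i 1) = 0) (v : E3) {s : ℝ} (hs0 : 0 < s) (hs : s < R) :
    ∫ η, inner ℝ v (s • η) * (fderiv ℝ w (s • η) (s • η) - w (s • η)) ∂sphereMean = 0 := by
  have hw1 := hw.of_le one_le_two
  have hdw := continuousOn_fderiv_self hw1
  refine sphereMean_smul_eq_zero (G := fun y => inner ℝ v y * (fderiv ℝ w y y - w y))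
    ((by fun_prop : ContinuousOn (fun y : E3 => (inner ℝ v y : ℝ)) _).mul
      (hdw.sub hw.continuousOn)) (fun h b hc hb0 hbR hb => ?_) hs0 hs
  obtain ⟨H, hH, hHd, hHb⟩ := exists_primitive_radial hc hb
  set ψ : E3 → ℝ := fun y => H (‖y‖ ^ 2) with hψdef
  have hψ : ContDiff ℝ 1 ψ := contDiff_radial hH
  have hcs : HasCompactSupport ψ := hasCompactSupport_radial hHb hb0
  have hts : tsupport ψ ⊆ ball 0 R :=
    (tsupport_radial_subset hHb hb0).trans (closedBall_subset_ball hbR)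
  have hin : ContDiff ℝ 1 fun y : E3 => (inner ℝ v y : ℝ) := contDiff_const.inner ℝ contDiff_id
  have hG := integral_radial_mul_fderiv_eq_zero isOpen_ball hw hlap (hψ.mul hin) hcs.mul_right
    ((closure_mono (Function.support_mul_subset_left _ _)).trans hts)
  have hP := integral_mul_fderiv_of_tsupport_subset isOpen_ball hψ hcs hts hw1 v
  have hfd : ∀ y z, fderiv ℝ ψ y z = 2 * h (‖y‖ ^ 2) * inner ℝ y z := fun y z => by
    rw [hψdef, fderiv_radial hH, hHd]
  have hprod : ∀ y z : E3, fderiv ℝ (fun y => ψ y * (inner ℝ v y : ℝ)) y z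
      = ψ y * inner ℝ v z + inner ℝ v y * (2 * h (‖y‖ ^ 2) * inner ℝ y z) := by
    intro y z
    rw [fderiv_fun_mul (hψ.differentiable one_ne_zero y) (hin.differentiable one_ne_zero y)]
    have : fderiv ℝ (fun y : E3 => (inner ℝ v y : ℝ)) y z = inner ℝ v z := by
      have := fderiv_inner_pow v y z 1
      simpa using this
    simp only [add_apply, smul_apply, smul_eq_mul, hfd, this]
  have hpt : ∀ y : E3, ∑ i, fderiv ℝ (fun y => ψ y * (inner ℝ v y : ℝ)) y (EuclideanSpace.single i 1) *
      fderiv ℝ w y (EuclideanSpace.single i 1)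
      = ψ y * fderiv ℝ w y v + 2 * (h (‖y‖ ^ 2) * (inner ℝ v y * fderiv ℝ w y y)) := by
    intro y
    simp only [hprod, inner_single_one]
    rw [← sum_apply_mul_single y (fderiv ℝ w y), ← sum_apply_mul_single v (fderiv ℝ w y)]
    simp only [Finset.mul_sum, ← Finset.sum_add_distrib]
    exact Finset.sum_congr rfl fun i _ => by ring
  simp only [hpt] at hG
  have hcomp : tsupport (fun y : E3 => h (‖y‖ ^ 2)) ⊆ closedBall 0 b := tsupport_radial_subset hb hb0
  have hcompc : HasCompactSupport (fun y : E3 => h (‖y‖ ^ 2)) :=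
    (isCompact_closedBall 0 b).of_isClosed_subset (isClosed_tsupport _) hcomp
  have hI {g : E3 → ℝ} (hg : ContinuousOn g (ball 0 R)) :
      Integrable fun y => h (‖y‖ ^ 2) * g y :=
    integrable_mul_of_tsupport_subset isOpen_ball (by fun_prop) hcompc
      (hcomp.trans (closedBall_subset_ball hbR)) hg
  have hI1 : Integrable fun y => ψ y * fderiv ℝ w y v :=
    integrable_mul_of_tsupport_subset isOpen_ball hψ.continuous hcs hts
      (continuousOn_fderiv_apply isOpen_ball hw1 v)
  have hinc : ContinuousOn (fun y : E3 => (inner ℝ v y : ℝ)) (ball 0 R) := by fun_prop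
  have hI2 : Integrable fun y : E3 => h (‖y‖ ^ 2) * (inner ℝ v y * fderiv ℝ w y y) :=
    hI (hinc.mul hdw)
  have hI3 : Integrable fun y : E3 => h (‖y‖ ^ 2) * (inner ℝ v y * w y) :=
    hI (hinc.mul hw.continuousOn)
  rw [integral_add hI1 (hI2.const_mul 2), hP, integral_const_mul] at hG
  have h3 : ∫ y, fderiv ℝ ψ y v * w y = 2 * ∫ y, h (‖y‖ ^ 2) * (inner ℝ v y * w y) := by
    rw [← integral_const_mul]
    congr 1
    funext y
    rw [hfd, real_inner_comm]
    ring
  rw [h3] at hG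
  have h4 : ∫ y : E3, h (‖y‖ ^ 2) * (inner ℝ v y * (fderiv ℝ w y y - w y))
      = (∫ y, h (‖y‖ ^ 2) * (inner ℝ v y * fderiv ℝ w y y))
        - ∫ y, h (‖y‖ ^ 2) * (inner ℝ v y * w y) := by
    rw [← integral_sub hI2 hI3]
    congr 1
    funext y
    ring
  rw [h4]
  linarith

theorem hasDerivAt_sphereMean_mul (hw : ContDiffOn ℝ 1 w (ball 0 R)) {g : E3 → ℝ}
    (hg : Continuous g) {s : ℝ} (hs : |s| < R) :
    HasDerivAt (fun s : ℝ => ∫ η, g η * w (s • η) ∂sphereMean)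
      (∫ η, g η * fderiv ℝ w (s • η) η ∂sphereMean) s := by
  obtain ⟨s₁, h1, h2⟩ := exists_between hs
  have hs1 : 0 < s₁ := (abs_nonneg s).trans_lt h1
  have hcD := hw.continuousOn_fderiv_of_isOpen isOpen_ball le_rfl
  obtain ⟨C, hC⟩ := (isCompact_closedBall (0 : E3) s₁).exists_bound_of_continuousOn
    (hcD.mono (closedBall_subset_ball h2))
  obtain ⟨K, hK⟩ := (isCompact_sphere (0 : E3) 1).exists_bound_of_continuousOn hg.continuousOn
  have hK' : ∀ η : E3, ‖η‖ = 1 → ‖g η‖ ≤ K := fun η hη => hK η (by simpa using hη)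
  have hmem : ∀ t : ℝ, |t| < s₁ → ∀ η : E3, ‖η‖ = 1 → t • η ∈ ball (0 : E3) R := fun t ht η hη => by
    simpa [norm_smul, hη] using ht.trans h2
  have hint : ∀ t : ℝ, |t| < s₁ → Integrable (fun η => g η * w (t • η)) sphereMean := fun t ht =>
    integrable_sphereMean (hg.continuousOn.mul (hw.continuousOn.comp (by fun_prop)
      fun η hη => hmem t ht η (by simpa using hη)))
  have hopen : {t : ℝ | |t| < s₁} ∈ 𝓝 s := (isOpen_lt continuous_abs continuous_const).mem_nhds h1
  refine (hasDerivAt_integral_of_dominated_loc_of_deriv_le (μ := sphereMean)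
    (F := fun t η => g η * w (t • η)) (F' := fun t η => g η * fderiv ℝ w (t • η) η) (bound := fun _ => K * C) hopen ?_
    (hint s h1) ?_ ?_ (integrable_const _) ?_).2
  · filter_upwards [hopen] with t ht using (hint t ht).aestronglyMeasurable
  · refine (integrable_sphereMean (hg.continuousOn.mul ((hcD.comp (by fun_prop)
      fun η hη => hmem s h1 η (by simpa using hη)).clm_apply continuousOn_id))).aestronglyMeasurable
  · filter_upwards [ae_norm_eq_one] with η hη t ht
    rw [norm_mul]
    have hKη := hK' η hη
    have h3 : ‖fderiv ℝ w (t • η) η‖ ≤ C := by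
      refine ((fderiv ℝ w (t • η)).le_opNorm η).trans ?_
      rw [hη, mul_one]
      refine hC _ ?_
      have : |t| < s₁ := ht
      simpa [norm_smul, hη] using this.le
    have : 0 ≤ K := (norm_nonneg _).trans hKη
    gcongr
  · filter_upwards [ae_norm_eq_one] with η hη t ht
    have hd : DifferentiableAt ℝ w (t • η) :=
      (hw.contDiffAt (isOpen_ball.mem_nhds (hmem t ht η hη))).differentiableAt one_ne_zero
    have h4 : HasDerivAt (fun t : ℝ => t • η) η t := by
      simpa using (hasDerivAt_id t).smul_const η
    exact (hd.hasFDerivAt.comp_hasDerivAt t h4).const_mul (g η)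

/-- The mean value property. -/
theorem sphereMean_eq_center (hw : ContDiffOn ℝ 2 w (ball 0 R))
    (hlap : ∀ y ∈ ball (0 : E3) R, ∑ i, fderiv ℝ (fun z => fderiv ℝ w z (EuclideanSpace.single i 1)) y
      (EuclideanSpace.single i 1) = 0) {s : ℝ} (hs0 : 0 < s) (hs : s < R) :
    ∫ η, w (s • η) ∂sphereMean = w 0 := by
  have hd : ∀ t ∈ Icc 0 s, HasDerivAt (fun s : ℝ => ∫ η, w (s • η) ∂sphereMean)
      (∫ η, fderiv ℝ w (t • η) η ∂sphereMean) t := fun t ht => by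
    simpa using hasDerivAt_sphereMean_mul (hw.of_le one_le_two) (g := fun _ => 1) continuous_const
      (s := t) (by rw [abs_of_nonneg ht.1]; exact ht.2.trans_lt hs)
  obtain ⟨t, ht, hslope⟩ := exists_hasDerivAt_eq_slope (fun s : ℝ => ∫ η, w (s • η) ∂sphereMean)
    (fun t => ∫ η, fderiv ℝ w (t • η) η ∂sphereMean) hs0
    (fun t ht => (hd t ht).continuousAt.continuousWithinAt)
    (fun t ht => hd t ⟨ht.1.le, ht.2.le⟩)
  have hz := sphereMean_fderiv_self_eq_zero hw hlap ht.1 (ht.2.trans hs)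
  simp only [map_smul, smul_eq_mul] at hz
  rw [integral_const_mul, mul_eq_zero] at hz
  have hz' := hz.resolve_left ht.1.ne'
  rw [hz', eq_comm, div_eq_zero_iff] at hslope
  have := hslope.resolve_right (by linarith)
  simp at this
  linarith

/-- The first order analogue of the mean value property. -/
theorem sphereMean_inner_mul (hw : ContDiffOn ℝ 2 w (ball 0 R))
    (hlap : ∀ y ∈ ball (0 : E3) R, ∑ i, fderiv ℝ (fun z => fderiv ℝ w z (EuclideanSpace.single i 1)) y
      (EuclideanSpace.single i 1) = 0) (v : E3) {s : ℝ} (hs0 : 0 < s) (hs : s < R) :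
    ∫ η, inner ℝ v η * w (s • η) ∂sphereMean = s / 3 * fderiv ℝ w 0 v := by
  set N : ℝ → ℝ := fun s => ∫ η, inner ℝ v η * w (s • η) ∂sphereMean with hN
  have hvc : Continuous fun η : E3 => (inner ℝ v η : ℝ) := by fun_prop
  have hd : ∀ t, |t| < R → HasDerivAt N (∫ η, inner ℝ v η * fderiv ℝ w (t • η) η ∂sphereMean) t :=
    fun t ht => hasDerivAt_sphereMean_mul (hw.of_le one_le_two) hvc ht
  have hR : 0 < R := hs0.trans hs
  have hcD := (hw.of_le one_le_two).continuousOn_fderiv_of_isOpen isOpen_ball le_rfl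
  -- Green's identity becomes the equation `t N'(t) = N(t)`, so `N t / t` is constant. As `N 0 = 0`,
  -- the constant is `N'(0)`, which the second moments of the sphere evaluate.
  have hode : ∀ t ∈ Ioo 0 R, t * ∫ η, inner ℝ v η * fderiv ℝ w (t • η) η ∂sphereMean = N t := by
    intro t ht
    have hmem : ∀ η ∈ sphere (0 : E3) 1, t • η ∈ ball (0 : E3) R := fun η hη => by
      rw [mem_sphere_zero_iff_norm] at hη
      simpa [norm_smul, hη, abs_of_pos ht.1] using ht.2
    have h := sphereMean_inner_mul_fderiv_self hw hlap v ht.1 ht.2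
    simp only [map_smul, smul_eq_mul, real_inner_smul_right] at h
    have h1 : Integrable (fun η => inner ℝ v η * fderiv ℝ w (t • η) η) sphereMean :=
      integrable_sphereMean (hvc.continuousOn.mul ((hcD.comp (by fun_prop) hmem).clm_apply
        continuousOn_id))
    have h2 : Integrable (fun η => inner ℝ v η * w (t • η)) sphereMean :=
      integrable_sphereMean (hvc.continuousOn.mul (hw.continuousOn.comp (by fun_prop) hmem))
    have h3 : ∀ η : E3, t * inner ℝ v η * (t * fderiv ℝ w (t • η) η - w (t • η))
        = t * (t * (inner ℝ v η * fderiv ℝ w (t • η) η) - inner ℝ v η * w (t • η)) := fun η => by ring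
    simp only [h3] at h
    rw [integral_const_mul, integral_sub (h1.const_mul _) h2, integral_const_mul] at h
    have := (mul_eq_zero.1 h).resolve_left ht.1.ne'
    linarith
  have hquot : ∀ t ∈ Ioo 0 R, HasDerivAt (fun t => N t / t) 0 t := by
    intro t ht
    have h := (hd t (by rw [abs_of_pos ht.1]; exact ht.2)).div (hasDerivAt_id t) ht.1.ne'
    have hz : ((∫ η, inner ℝ v η * fderiv ℝ w (t • η) η ∂sphereMean) * id t - N t * 1) / id t ^ 2
        = 0 := by
      rw [id, mul_comm, hode t ht]
      ring
    rwa [hz] at h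
  have hconst : ∀ t ∈ Ioo 0 R, N t / t = N s / s := by
    intro t ht
    exact isOpen_Ioo.is_const_of_deriv_eq_zero isPreconnected_Ioo
      (fun x hx => (hquot x hx).differentiableAt.differentiableWithinAt)
      (fun x hx => (hquot x hx).deriv) ht ⟨hs0, hs⟩
  have h0 := hd 0 (by simpa using hR)
  have hN0 : N 0 = 0 := by
    simp only [hN, zero_smul]
    rw [integral_mul_const, integral_sphereMean_inner_self, zero_mul]
  have hlim : Tendsto (fun t => N t / t) (𝓝[>] 0)
      (𝓝 (∫ η, inner ℝ v η * fderiv ℝ w ((0 : ℝ) • η) η ∂sphereMean)) := by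
    have := (hasDerivAt_iff_tendsto_slope.1 h0).mono_left
      (nhdsWithin_mono (0 : ℝ) (fun x (hx : 0 < x) => (ne_of_gt hx : x ≠ 0)))
    refine this.congr fun t => ?_
    rw [slope_def_field, hN0, sub_zero, sub_zero]
  have hlim2 : Tendsto (fun t => N t / t) (𝓝[>] 0) (𝓝 (N s / s)) := by
    refine tendsto_const_nhds.congr' ?_
    filter_upwards [Ioo_mem_nhdsGT hR] with t ht using (hconst t ht).symm
  have hfin := tendsto_nhds_unique hlim hlim2
  simp only [zero_smul] at hfin
  have hrep : ∀ η : E3, fderiv ℝ w 0 η = inner ℝ ((InnerProductSpace.toDual ℝ E3).symm (fderiv ℝ w 0)) η :=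
    fun η => by simp
  simp only [hrep] at hfin
  rw [integral_sphereMean_inner_mul_inner, real_inner_comm, ← hrep] at hfin
  field_simp at hfin ⊢
  linarith

end MeanValue

/-! ### The Kelvin transform preserves harmonicity -/

theorem fderiv_fderiv_apply {u : E3 → ℝ} {y : E3} (hu : ContDiffAt ℝ 2 u y) (v z : E3) :
    fderiv ℝ (fun z => fderiv ℝ u z v) y z = fderiv ℝ (fderiv ℝ u) y z v := by
  have hd : DifferentiableAt ℝ (fderiv ℝ u) y :=
    (hu.fderiv_right (m := 1) (by norm_num)).differentiableAt one_ne_zero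
  have := hd.hasFDerivAt.clm_apply (hasFDerivAt_const v y)
  rw [this.fderiv]
  simp

theorem InnerProductSpace.HarmonicAt.sum_fderiv_fderiv {u : E3 → ℝ} {y : E3} (hu : HarmonicAt u y)
    (b : OrthonormalBasis (Fin 3) ℝ E3) : ∑ i, fderiv ℝ (fderiv ℝ u) y (b i) (b i) = 0 := by
  have h := hu.2.eq_of_nhds
  rw [laplacian_eq_iteratedFDeriv_orthonormalBasis u b] at h
  simpa [iteratedFDeriv_two_apply] using h

theorem hasDerivAt_inv_norm_line {z e : E3} (hz : z ≠ 0) :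
    HasDerivAt (fun t : ℝ => ‖z + t • e‖⁻¹) (-(inner ℝ z e * ‖z‖⁻¹ ^ 3)) 0 := by
  have hl : HasDerivAt (fun t : ℝ => z + t • e) e 0 := by
    simpa using ((hasDerivAt_id (0 : ℝ)).smul_const e).const_add z
  have h1 : HasDerivAt (fun t : ℝ => ‖z + t • e‖ ^ 2) (2 * inner ℝ z e) 0 := by
    simpa using hl.norm_sq
  have hn : ‖z‖ ≠ 0 := norm_ne_zero_iff.2 hz
  have h2 := (h1.sqrt (by simpa using hn)).inv (by simpa using hn)
  simp only [Real.sqrt_sq (norm_nonneg _), zero_smul, add_zero] at h2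
  refine HasDerivAt.congr_deriv (f := fun t : ℝ => ‖z + t • e‖⁻¹) h2 ?_
  field_simp

section Kelvin

variable {u : E3 → ℝ} {U V : Set E3} {p : E3} {ρ : ℝ}

/-- The inversion with centre `p` and power `ρ`. -/
noncomputable def inversionMap (p : E3) (ρ : ℝ) (y : E3) : E3 :=
  p + (ρ * ‖y - p‖⁻¹ ^ 2) • (y - p)

theorem contDiffOn_inv_norm_sub (hp : p ∉ U) : ContDiffOn ℝ 2 (fun y => ‖y - p‖⁻¹) U := by
  have h (y) (hy : y ∈ U) : y - p ≠ 0 := sub_ne_zero.2 fun h => hp (h ▸ hy)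
  exact ((contDiffOn_id.sub contDiffOn_const).norm ℝ h).inv fun y hy => norm_ne_zero_iff.2 (h y hy)

theorem contDiffOn_inversionMap (hp : p ∉ U) : ContDiffOn ℝ 2 (inversionMap p ρ) U :=
  contDiffOn_const.add ((contDiffOn_const.mul ((contDiffOn_inv_norm_sub hp).pow 2)).smul
    (contDiffOn_id.sub contDiffOn_const))

theorem hasDerivAt_inversionMap_line {y : E3} (hy : y ≠ p) (e : E3) :
    HasDerivAt (fun t : ℝ => inversionMap p ρ (y + t • e))
      (ρ • (‖y - p‖⁻¹ ^ 2 • e - (2 * inner ℝ (y - p) e * ‖y - p‖⁻¹ ^ 4) • (y - p))) 0 := by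
  have hm := hasDerivAt_inv_norm_line (e := e) (sub_ne_zero.2 hy)
  have hl : HasDerivAt (fun t : ℝ => y - p + t • e) e 0 := by
    simpa using ((hasDerivAt_id (0 : ℝ)).smul_const e).const_add (y - p)
  have h := (((hm.pow 2).const_mul ρ).smul hl).const_add p
  have hfun : (fun t : ℝ => inversionMap p ρ (y + t • e))
      = fun t : ℝ => p + (ρ * ‖y - p + t • e‖⁻¹ ^ 2) • (y - p + t • e) := by
    funext t
    rw [inversionMap, show y + t • e - p = y - p + t • e by abel]
  rw [hfun]
  refine h.congr_deriv ?_
  simp only [zero_smul, add_zero, Pi.pow_apply]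
  module

theorem hasDerivAt_comp_inversionMap_line {F : Type*} [NormedAddCommGroup F] [NormedSpace ℝ F]
    {f : E3 → F} {f' : E3 →L[ℝ] F} {y : E3} (hf : HasFDerivAt f f' (inversionMap p ρ y))
    (hy : y ≠ p) (e : E3) :
    HasDerivAt (fun t : ℝ => f (inversionMap p ρ (y + t • e)))
      (f' (ρ • (‖y - p‖⁻¹ ^ 2 • e - (2 * inner ℝ (y - p) e * ‖y - p‖⁻¹ ^ 4) • (y - p)))) 0 := by
  have h0 : inversionMap p ρ (y + (0 : ℝ) • e) = inversionMap p ρ y := by simp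
  rw [← h0] at hf
  exact hf.comp_hasDerivAt (0 : ℝ) (hasDerivAt_inversionMap_line hy e)

theorem contDiffOn_kelvin (hu : ContDiffOn ℝ 2 u V) (hp : p ∉ U)
    (hUV : MapsTo (inversionMap p ρ) U V) :
    ContDiffOn ℝ 2 (fun y => ‖y - p‖⁻¹ * u (inversionMap p ρ y)) U :=
  (contDiffOn_inv_norm_sub hp).mul (hu.comp (contDiffOn_inversionMap hp) hUV)

theorem fderiv_kelvin (hU : IsOpen U) (hV : IsOpen V) (hu : ContDiffOn ℝ 2 u V) (hp : p ∉ U)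
    (hUV : MapsTo (inversionMap p ρ) U V) {y : E3} (hy : y ∈ U) (e : E3) :
    fderiv ℝ (fun y => ‖y - p‖⁻¹ * u (inversionMap p ρ y)) y e
      = -(inner ℝ (y - p) e * ‖y - p‖⁻¹ ^ 3) * u (inversionMap p ρ y)
        + ρ * fderiv ℝ u (inversionMap p ρ y)
          (‖y - p‖⁻¹ ^ 3 • e - (2 * inner ℝ (y - p) e * ‖y - p‖⁻¹ ^ 5) • (y - p)) := by
  have hyp : y ≠ p := fun h => hp (h ▸ hy)
  have hd : DifferentiableAt ℝ (fun y => ‖y - p‖⁻¹ * u (inversionMap p ρ y)) y :=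
    ((contDiffOn_kelvin hu hp hUV).contDiffAt (hU.mem_nhds hy)).differentiableAt two_ne_zero
  have hdu : DifferentiableAt ℝ u (inversionMap p ρ y) :=
    (hu.contDiffAt (hV.mem_nhds (hUV hy))).differentiableAt two_ne_zero
  rw [← hd.lineDeriv_eq_fderiv]
  have h1 := (hasDerivAt_inv_norm_line (e := e) (sub_ne_zero.2 hyp)).mul
    (hasDerivAt_comp_inversionMap_line hdu.hasFDerivAt hyp e)
  have hfun : (fun t : ℝ => (fun y => ‖y - p‖⁻¹ * u (inversionMap p ρ y)) (y + t • e))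
      = fun t : ℝ => ‖y - p + t • e‖⁻¹ * u (inversionMap p ρ (y + t • e)) := by
    funext t
    simp only [show y + t • e - p = y - p + t • e by abel]
  rw [lineDeriv, hfun]
  refine (HasDerivAt.deriv (f := fun t : ℝ => ‖y - p + t • e‖⁻¹ * u (inversionMap p ρ (y + t • e)))
    h1).trans ?_
  simp only [zero_smul, add_zero, map_smul, map_sub, smul_eq_mul]
  ring

theorem sum_fderiv_fderiv_kelvin (hU : IsOpen U) (hV : IsOpen V) (hu : HarmonicOnNhd u V)
    (hp : p ∉ U) (hUV : MapsTo (inversionMap p ρ) U V) {y : E3} (hy : y ∈ U) :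
    ∑ i, fderiv ℝ (fun z => fderiv ℝ (fun y => ‖y - p‖⁻¹ * u (inversionMap p ρ y)) z
      (EuclideanSpace.single i 1)) y (EuclideanSpace.single i 1) = 0 := by
  have hyp : y ≠ p := fun h => hp (h ▸ hy)
  have hz : y - p ≠ 0 := sub_ne_zero.2 hyp
  set z := y - p with hzdef
  set m := ‖z‖⁻¹ with hm
  set q := inversionMap p ρ y with hq
  set D := fderiv ℝ u q with hD
  set Q := fderiv ℝ (fderiv ℝ u) q with hQ
  have hu2 : ContDiffAt ℝ 2 u q := (hu q (hUV hy)).1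
  have hk := contDiffOn_kelvin hu.contDiffOn hp hUV
  -- The second derivative in direction `e` is sorted by the order of the derivative of `u`. After
  -- summing over a basis each group vanishes separately.
  have hterm : ∀ e : E3, ‖e‖ = 1 →
      fderiv ℝ (fun z => fderiv ℝ (fun y => ‖y - p‖⁻¹ * u (inversionMap p ρ y)) z e) y e
      = (-m ^ 3 + 3 * (inner ℝ z e) ^ 2 * m ^ 5) * u q
        + ρ * m ^ 5 * D ((-6 * inner ℝ z e) • e - (2 : ℝ) • z + (12 * (inner ℝ z e) ^ 2 * m ^ 2) • z)
        + ρ ^ 2 * m ^ 5 * Q ((2 * (inner ℝ z e * m ^ 2)) • z - e) ((2 * (inner ℝ z e * m ^ 2)) • z - e) := by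
    intro e he
    have hd : DifferentiableAt ℝ
        (fun z => fderiv ℝ (fun y => ‖y - p‖⁻¹ * u (inversionMap p ρ y)) z e) y :=
      (((hk.fderiv_of_isOpen hU (m := 1) (by norm_num)).clm_apply contDiffOn_const).contDiffAt
        (hU.mem_nhds hy)).differentiableAt one_ne_zero
    rw [← hd.lineDeriv_eq_fderiv]
    have hev : (fun x => fderiv ℝ (fun y => ‖y - p‖⁻¹ * u (inversionMap p ρ y)) x e) =ᶠ[𝓝 y]
        fun y => -(inner ℝ (y - p) e * ‖y - p‖⁻¹ ^ 3) * u (inversionMap p ρ y)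
        + ρ * fderiv ℝ u (inversionMap p ρ y)
          (‖y - p‖⁻¹ ^ 3 • e - (2 * inner ℝ (y - p) e * ‖y - p‖⁻¹ ^ 5) • (y - p)) := by
      filter_upwards [hU.mem_nhds hy] with x hx
      exact fderiv_kelvin hU hV hu.contDiffOn hp hUV hx e
    rw [hev.lineDeriv_eq]
    have hmd := hasDerivAt_inv_norm_line (e := e) hz
    have hl : HasDerivAt (fun t : ℝ => z + t • e) e 0 := by
      simpa using ((hasDerivAt_id (0 : ℝ)).smul_const e).const_add z
    have ha : HasDerivAt (fun t : ℝ => (inner ℝ (z + t • e) e : ℝ)) 1 0 := by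
      simpa [real_inner_self_eq_norm_sq, he] using hl.inner ℝ (hasDerivAt_const (0 : ℝ) e)
    have hud := hasDerivAt_comp_inversionMap_line
      (hu2.differentiableAt two_ne_zero).hasFDerivAt hyp e
    have hDd := hasDerivAt_comp_inversionMap_line
      ((hu2.fderiv_right (m := 1) (by norm_num)).differentiableAt one_ne_zero).hasFDerivAt hyp e
    have hv := ((hmd.pow 3).smul_const e).sub (((ha.const_mul 2).mul (hmd.pow 5)).smul hl)
    have htot := ((ha.mul (hmd.pow 3)).neg.mul hud).add ((hDd.clm_apply hv).const_mul ρ)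
    have hfun (t : ℝ) : y + t • e - p = z + t • e := by rw [hzdef]; abel
    simp only [lineDeriv, hfun]
    refine (HasDerivAt.deriv (f := fun t : ℝ => -(inner ℝ (z + t • e) e * ‖z + t • e‖⁻¹ ^ 3) *
      u (inversionMap p ρ (y + t • e)) + ρ * fderiv ℝ u (inversionMap p ρ (y + t • e))
        (‖z + t • e‖⁻¹ ^ 3 • e - (2 * inner ℝ (z + t • e) e * ‖z + t • e‖⁻¹ ^ 5) • (z + t • e)))
      htot).trans ?_
    simp only [zero_smul, add_zero, map_smul, map_sub, map_add, smul_eq_mul, Pi.mul_apply, Pi.smul_apply',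
      Pi.sub_apply, Pi.pow_apply, Pi.neg_apply, sub_apply, smul_apply, ← hq, ← hD, ← hQ, ← hm, ← hzdef]
    push_cast
    ring
  have hnorm (i : Fin 3) : ‖(EuclideanSpace.single i (1 : ℝ) : E3)‖ = 1 := by simp
  rw [Finset.sum_congr rfl fun i _ => hterm _ (hnorm i)]
  simp only [inner_single_one]
  have hzn : ∑ i, z i ^ 2 = ‖z‖ ^ 2 := (EuclideanSpace.real_norm_sq_eq z).symm
  have hmz : ‖z‖ ^ 2 * m ^ 2 = 1 := by
    rw [← mul_pow, hm, mul_inv_cancel₀ (norm_ne_zero_iff.2 hz), one_pow]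
  rw [Finset.sum_add_distrib, Finset.sum_add_distrib, ← Finset.sum_mul, ← Finset.mul_sum,
    ← Finset.mul_sum, ← map_sum]
  have e1 : ∑ i : Fin 3, (-m ^ 3 + 3 * z i ^ 2 * m ^ 5) = 0 := by
    rw [Finset.sum_add_distrib, ← Finset.sum_mul, ← Finset.mul_sum, hzn]
    simp only [Finset.sum_const, Finset.card_univ, Fintype.card_fin, nsmul_eq_mul]
    push_cast
    linear_combination 3 * m ^ 3 * hmz
  have e2 : ∑ i : Fin 3, ((-6 * z i) • (EuclideanSpace.single i (1 : ℝ) : E3) - (2 : ℝ) • z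
      + (12 * z i ^ 2 * m ^ 2) • z) = 0 := by
    have hs : ∑ i : Fin 3, z i • (EuclideanSpace.single i (1 : ℝ) : E3) = z := by
      simpa using (EuclideanSpace.basisFun (Fin 3) ℝ).sum_repr z
    have hs' : ∑ i : Fin 3, (12 * z i ^ 2 * m ^ 2) • z = (12 : ℝ) • z := by
      rw [← Finset.sum_smul, ← Finset.sum_mul, ← Finset.mul_sum, hzn, mul_assoc, hmz, mul_one]
    rw [Finset.sum_add_distrib, Finset.sum_sub_distrib, hs']
    simp only [mul_smul, ← Finset.smul_sum, hs]
    simp only [Finset.sum_const, Finset.card_univ, Fintype.card_fin]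
    module
  -- The vectors `2⟨z,e⟩z/|z|² - e` are the reflections of the basis vectors in the line `ℝz`. They
  -- form an orthonormal basis, so the sum is the Laplacian of `u` at the image point.
  have e3 : ∑ i : Fin 3, Q ((2 * (z i * m ^ 2)) • z - EuclideanSpace.single i 1)
      ((2 * (z i * m ^ 2)) • z - EuclideanSpace.single i 1) = 0 := by
    have h := (hu q (hUV hy)).sum_fderiv_fderiv
      ((EuclideanSpace.basisFun (Fin 3) ℝ).map (ℝ ∙ z).reflection)
    refine Eq.trans (Finset.sum_congr rfl fun i _ => ?_) h
    have hr : ((EuclideanSpace.basisFun (Fin 3) ℝ).map (ℝ ∙ z).reflection) i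
        = (2 * (z i * m ^ 2)) • z - EuclideanSpace.single i 1 := by
      rw [OrthonormalBasis.map_apply, Submodule.reflection_singleton_apply]
      simp only [EuclideanSpace.basisFun_apply, inner_single_one, hm]
      simp only [RCLike.ofReal_real_eq_id, id, two_smul, two_mul, add_smul, div_eq_mul_inv, inv_pow]
    rw [hr]
  rw [e1, e2, e3]
  simp

end Kelvin

theorem InnerProductSpace.HarmonicOnNhd.sum_fderiv_single {u : E3 → ℝ} {V : Set E3}
    (hu : HarmonicOnNhd u V) : ∀ y ∈ V, ∑ i, fderiv ℝ (fun z => fderiv ℝ u z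
      (EuclideanSpace.single i 1)) y (EuclideanSpace.single i 1) = 0 := by
  intro y hy
  have h := (hu y hy).sum_fderiv_fderiv (EuclideanSpace.basisFun (Fin 3) ℝ)
  simp only [EuclideanSpace.basisFun_apply] at h
  simpa only [fderiv_fderiv_apply (hu y hy).1] using h

/-! ### The duality bound, first at the centre and then at an arbitrary point -/

/-- On the sphere of radius `s < 1` the two mean value formulas write the left side, up to factors
of `s`, as the mean of `(A + B⟨v,sη⟩) W(sη)`. No boundary values of `W` are needed: `W` is bounded
by `k`, which is continuous past the unit sphere, before `s → 1`. -/
theorem affine_center_le_sphereMean {W k : E3 → ℝ} {R : ℝ} (hW : ContDiffOn ℝ 2 W (ball 0 1))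
    (hlap : ∀ y ∈ ball (0 : E3) 1, ∑ i, fderiv ℝ (fun z => fderiv ℝ W z (EuclideanSpace.single i 1)) y
      (EuclideanSpace.single i 1) = 0)
    (hR : 1 < R) (hk : ContinuousOn k (ball 0 R)) (hWk : ∀ y ∈ ball (0 : E3) 1, |W y| ≤ k y)
    (A B : ℝ) (v : E3) :
    A * W 0 + B / 3 * fderiv ℝ W 0 v ≤ ∫ η, |A + B * inner ℝ v η| * k η ∂sphereMean := by
  have hGc : ContinuousOn (fun y : E3 => |A + B * inner ℝ v y| * k y) (ball 0 R) :=
    ContinuousOn.mul (by fun_prop) hk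
  have hlim := (continuousAt_sphereMean_smul (s := 1) hGc (by simpa using hR)).tendsto
  simp only [one_smul] at hlim
  have hlim' : Tendsto (fun s : ℝ => A * W 0 + B * s * (s / 3 * fderiv ℝ W 0 v)) (𝓝[<] 1)
      (𝓝 (A * W 0 + B * 1 * (1 / 3 * fderiv ℝ W 0 v))) := by
    refine Tendsto.mono_left (Continuous.tendsto ?_ 1) nhdsWithin_le_nhds
    fun_prop
  have hle := le_of_tendsto_of_tendsto hlim' (hlim.mono_left nhdsWithin_le_nhds) ?_
  · linarith
  filter_upwards [Ioo_mem_nhdsLT (zero_lt_one (α := ℝ))] with s hs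
  have hmem : ∀ {R' : ℝ}, s < R' → ∀ η ∈ sphere (0 : E3) 1, s • η ∈ ball (0 : E3) R' := by
    intro R' h η hη
    rw [mem_sphere_zero_iff_norm] at hη
    simpa [norm_smul, hη, abs_of_pos hs.1] using h
  have hWs : ContinuousOn (fun η => W (s • η)) (sphere 0 1) :=
    hW.continuousOn.comp (by fun_prop) (hmem hs.2)
  have hvs : Continuous fun η : E3 => (inner ℝ v η : ℝ) := by fun_prop
  rw [← sphereMean_inner_mul hW hlap v hs.1 hs.2, ← sphereMean_eq_center hW hlap hs.1 hs.2,
    ← integral_const_mul, ← integral_const_mul, ← integral_add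
      ((integrable_sphereMean hWs).const_mul _)
      ((integrable_sphereMean (F := fun η => inner ℝ v η * W (s • η))
        (hvs.continuousOn.mul hWs)).const_mul _)]
  refine integral_mono_ae (((integrable_sphereMean hWs).const_mul _).add
      ((integrable_sphereMean (F := fun η => inner ℝ v η * W (s • η))
        (hvs.continuousOn.mul hWs)).const_mul _))
    (integrable_sphereMean (hGc.comp (by fun_prop) (hmem (hs.2.trans hR)))) ?_
  filter_upwards [ae_norm_eq_one] with η hη
  have h1 := hWk (s • η) (hmem hs.2 η (by simpa using hη))
  calc A * W (s • η) + B * s * (inner ℝ v η * W (s • η))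
      = (A + B * inner ℝ v (s • η)) * W (s • η) := by rw [real_inner_smul_right]; ring
    _ ≤ |(A + B * inner ℝ v (s • η)) * W (s • η)| := le_abs_self _
    _ = |A + B * inner ℝ v (s • η)| * |W (s • η)| := abs_mul _ _
    _ ≤ _ := by
      gcongr

section Pole

variable {x : E3}

/-- The inverse point of `x` with respect to the unit sphere. -/
noncomputable def inversePoint (x : E3) : E3 := (‖x‖⁻¹ ^ 2) • x

theorem norm_inversePoint (hx : x ≠ 0) : ‖inversePoint x‖ = ‖x‖⁻¹ := by
  have := norm_ne_zero_iff.2 hx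
  rw [inversePoint, norm_smul, norm_pow, norm_inv, norm_norm]
  field_simp

theorem one_lt_norm_inversePoint (hx : x ≠ 0) (hx1 : ‖x‖ < 1) : 1 < ‖inversePoint x‖ := by
  rw [norm_inversePoint hx]
  exact (one_lt_inv₀ (norm_pos_iff.2 hx)).2 hx1

/-- The power `|p|² - 1` is the one for which the inversion preserves the unit sphere; for `|p| > 1`
the identity shows that the ball is preserved as well. -/
theorem one_sub_norm_inversionMap_sq {p y : E3} (hy : y ≠ p) :
    1 - ‖inversionMap p (‖p‖ ^ 2 - 1) y‖ ^ 2 = (‖p‖ ^ 2 - 1) * ‖y - p‖⁻¹ ^ 2 * (1 - ‖y‖ ^ 2) := by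
  have hz : ‖y - p‖ ≠ 0 := norm_ne_zero_iff.2 (sub_ne_zero.2 hy)
  have h1 : ‖y‖ ^ 2 = ‖p‖ ^ 2 + 2 * inner ℝ p (y - p) + ‖y - p‖ ^ 2 := by
    rw [← norm_add_sq_real]; congr 2; abel
  rw [inversionMap, norm_add_sq_real, norm_smul, real_inner_smul_right, mul_pow, Real.norm_eq_abs,
    sq_abs, h1]
  field_simp
  ring

theorem mapsTo_inversionMap {p : E3} (hp : 1 < ‖p‖) :
    MapsTo (inversionMap p (‖p‖ ^ 2 - 1)) (ball 0 1) (ball 0 1) := by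
  intro y hy
  rw [mem_ball_zero_iff] at hy ⊢
  have hyp : y ≠ p := fun h => by rw [h] at hy; linarith
  have hz : 0 < ‖y - p‖ := norm_pos_iff.2 (sub_ne_zero.2 hyp)
  have h := one_sub_norm_inversionMap_sq hyp
  have h1 : 0 < ‖p‖ ^ 2 - 1 := by nlinarith
  have h2 : 0 < 1 - ‖y‖ ^ 2 := by nlinarith [norm_nonneg y]
  have h3 : 0 < (‖p‖ ^ 2 - 1) * ‖y - p‖⁻¹ ^ 2 * (1 - ‖y‖ ^ 2) := by positivity
  nlinarith [norm_nonneg (inversionMap p (‖p‖ ^ 2 - 1) y)]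

theorem inversionMap_inversePoint_zero (hx : x ≠ 0) :
    inversionMap (inversePoint x) (‖inversePoint x‖ ^ 2 - 1) 0 = x := by
  have hn := norm_ne_zero_iff.2 hx
  rw [inversionMap, zero_sub, norm_neg, norm_inversePoint hx, inv_inv, inversePoint, smul_neg,
    smul_smul, ← sub_eq_add_neg, ← sub_smul]
  convert one_smul ℝ x
  field_simp
  ring

/-- The unit sphere is an Apollonius sphere of `x` and its inverse point: the ratio of the distances
to the two is constant on it. -/
theorem norm_inversePoint_mul_inv (hx : x ≠ 0) {η : E3} (hη : ‖η‖ = 1) :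
    ‖inversePoint x‖ * ‖η - inversePoint x‖⁻¹ = ‖x - η‖⁻¹ := by
  have hn := norm_ne_zero_iff.2 hx
  rw [norm_inversePoint hx, ← mul_inv]
  congr 1
  have h : (‖x‖ * ‖η - inversePoint x‖) ^ 2 = ‖x - η‖ ^ 2 := by
    rw [mul_pow, norm_sub_sq_real, norm_sub_sq_real, norm_inversePoint hx, inversePoint,
      real_inner_smul_right, hη, real_inner_comm]
    field_simp
  exact (sq_eq_sq₀ (by positivity) (norm_nonneg _)).1 h

theorem fderiv_kelvin_inversePoint {u : E3 → ℝ} {U V : Set E3} (hx : x ≠ 0)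
    (hU : IsOpen U) (hV : IsOpen V) (hu : ContDiffOn ℝ 2 u V) (hp : inversePoint x ∉ U)
    (hUV : MapsTo (inversionMap (inversePoint x) (‖inversePoint x‖ ^ 2 - 1)) U V) (h0 : (0 : E3) ∈ U)
    (v : E3) :
    fderiv ℝ (fun y => ‖inversePoint x‖ * (‖y - inversePoint x‖⁻¹ *
        u (inversionMap (inversePoint x) (‖inversePoint x‖ ^ 2 - 1) y))) 0 v
      = inner ℝ x v * u x - (1 - ‖x‖ ^ 2) * fderiv ℝ u x ((ℝ ∙ x).reflection v) := by
  have hn := norm_ne_zero_iff.2 hx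
  have hd := ((contDiffOn_kelvin hu hp hUV).contDiffAt (hU.mem_nhds h0)).differentiableAt two_ne_zero
  rw [fderiv_const_mul hd, smul_apply, smul_eq_mul, fderiv_kelvin hU hV hu hp hUV h0 v,
    inversionMap_inversePoint_zero hx, Submodule.reflection_singleton_apply]
  simp only [zero_sub, norm_neg, norm_inversePoint hx, inv_inv]
  simp only [inner_neg_left, inversePoint,
    real_inner_smul_left, map_sub, map_neg, map_smul, smul_eq_mul, two_smul, map_add, smul_neg,
    RCLike.ofReal_real_eq_id, id]
  field_simp
  ring

end Pole

/-- The function `|y - p|⁻¹`, the Kelvin transform of `1`, is harmonic in the ball of radius `|p| >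
1`. The mean value formulas therefore apply to it on the unit sphere itself. -/
theorem integral_inv_norm_sub_aux {x : E3} (hx : ‖x‖ < 1) :
    ∫ η, ‖x - η‖⁻¹ ∂sphereMean = 1 ∧
      ∀ v : E3, ∫ η, inner ℝ v η * ‖x - η‖⁻¹ ∂sphereMean = inner ℝ x v / 3 := by
  by_cases hx0 : x = 0
  · have h1 : ∀ᵐ η ∂sphereMean, ‖x - η‖⁻¹ = 1 := by
      filter_upwards [ae_norm_eq_one] with η hη
      simp [hx0, hη]
    constructor
    · rw [integral_congr_ae h1]; simp
    · intro v
      have : ∀ᵐ η ∂sphereMean, inner ℝ v η * ‖x - η‖⁻¹ = inner ℝ v η := by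
        filter_upwards [h1] with η hη
        rw [hη, mul_one]
      rw [integral_congr_ae this, integral_sphereMean_inner_self, hx0]
      simp
  set p := inversePoint x with hp
  have hp1 := one_lt_norm_inversePoint hx0 hx
  have hpU : p ∉ ball (0 : E3) ‖p‖ := by simp
  have hu : HarmonicOnNhd (fun _ : E3 => (1 : ℝ)) univ := harmonicOnNhd_const 1
  have hmaps : MapsTo (inversionMap p (‖p‖ ^ 2 - 1)) (ball 0 ‖p‖) univ := mapsTo_univ _ _
  have hC := contDiffOn_kelvin hu.contDiffOn hpU hmaps
  have hL : ∀ y ∈ ball (0 : E3) ‖p‖, _ := fun y hy =>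
    sum_fderiv_fderiv_kelvin isOpen_ball isOpen_univ hu hpU hmaps hy
  have hpp : 0 < ‖p‖ := zero_lt_one.trans hp1
  constructor
  · have h := sphereMean_eq_center hC hL one_pos hp1
    simp only [one_smul, mul_one, zero_sub, norm_neg] at h
    rw [← mul_inv_cancel₀ hpp.ne', ← h, ← integral_const_mul]
    refine integral_congr_ae ?_
    filter_upwards [ae_norm_eq_one] with η hη
    exact (norm_inversePoint_mul_inv hx0 hη).symm
  · intro v
    have h := sphereMean_inner_mul hC hL v one_pos hp1
    have hf := fderiv_kelvin_inversePoint hx0 isOpen_ball isOpen_univ hu.contDiffOn hpU hmaps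
      (mem_ball_self hpp) v
    rw [fderiv_const_mul ((hC.contDiffAt (isOpen_ball.mem_nhds
      (mem_ball_self hpp))).differentiableAt two_ne_zero), smul_apply, smul_eq_mul] at hf
    simp only [one_smul, mul_one, fderiv_fun_const, Pi.zero_apply, zero_apply, mul_zero,
      sub_zero] at h hf
    rw [← hf]
    rw [show ∀ a : ℝ, ‖p‖ * a / 3 = ‖p‖ * (1 / 3 * a) by intro a; ring, ← h, ← integral_const_mul]
    refine integral_congr_ae ?_
    filter_upwards [ae_norm_eq_one] with η hη
    rw [← norm_inversePoint_mul_inv hx0 hη]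
    ring

/-- The central bound applied to the Kelvin transform of `u`, multiplied by `|p|`. Its gradient at
`0` involves the reflection `S` in the line `ℝx`, so the direction used is `S e`; the substitution
`η ↦ S η`, which fixes `x`, then removes `S` from the integral. -/
theorem affine_le_integral_abs {u : E3 → ℝ} (hu : HarmonicOnNhd u (ball 0 1))
    (hb : ∀ y ∈ ball (0 : E3) 1, |u y| ≤ 1) {x : E3} (hx : ‖x‖ < 1) (e : E3) (A B : ℝ) :
    A * u x + B / 3 * ((1 - ‖x‖ ^ 2) * fderiv ℝ u x e - inner ℝ x e * u x)
      ≤ ∫ η, |A - B * inner ℝ e η| * ‖x - η‖⁻¹ ∂sphereMean := by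
  by_cases hx0 : x = 0
  · have h := affine_center_le_sphereMean (k := fun _ => 1) hu.contDiffOn hu.sum_fderiv_single
      one_lt_two continuousOn_const hb A B e
    rw [← integral_sphereMean_comp_isometry (LinearIsometryEquiv.neg ℝ)] at h
    subst hx0
    have : ∫ η, |A - B * inner ℝ e η| * ‖0 - η‖⁻¹ ∂sphereMean
        = ∫ η, |A + B * inner ℝ e (LinearIsometryEquiv.neg ℝ η)| * 1 ∂sphereMean := by
      refine integral_congr_ae ?_
      filter_upwards [ae_norm_eq_one] with η hη
      simp [hη, sub_eq_add_neg]
    rw [this]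
    simpa using h
  set p := inversePoint x with hp
  have hp1 := one_lt_norm_inversePoint hx0 hx
  have hpp : 0 < ‖p‖ := zero_lt_one.trans hp1
  have hpU : p ∉ ball (0 : E3) 1 := by
    rw [mem_ball_zero_iff]
    exact hp1.le.not_gt
  have hmaps := mapsTo_inversionMap hp1
  have hC := contDiffOn_kelvin hu.contDiffOn hpU hmaps
  have hL : ∀ y ∈ ball (0 : E3) 1, _ := fun y hy =>
    sum_fderiv_fderiv_kelvin isOpen_ball isOpen_ball hu hpU hmaps hy
  have hkc : ContinuousOn (fun y => ‖y - p‖⁻¹) (ball 0 ‖p‖) :=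
    (contDiffOn_inv_norm_sub (by simp)).continuousOn
  have hbound : ∀ y ∈ ball (0 : E3) 1,
      |‖y - p‖⁻¹ * u (inversionMap p (‖p‖ ^ 2 - 1) y)| ≤ ‖y - p‖⁻¹ := fun y hy => by
    rw [abs_mul, abs_of_nonneg (by positivity)]
    exact mul_le_of_le_one_right (by positivity) (hb _ (hmaps hy))
  set S := (ℝ ∙ x).reflection with hS
  have h := affine_center_le_sphereMean hC hL hp1 hkc hbound A (-B) (S e)
  have hf := fderiv_kelvin_inversePoint hx0 isOpen_ball isOpen_ball hu.contDiffOn hpU hmaps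
    (mem_ball_self one_pos) (S e)
  rw [fderiv_const_mul ((hC.contDiffAt (isOpen_ball.mem_nhds
    (mem_ball_self one_pos))).differentiableAt two_ne_zero), smul_apply, smul_eq_mul,
    hS, Submodule.reflection_reflection] at hf
  have hSx : S x = x := Submodule.reflection_mem_subspace_eq_self (Submodule.mem_span_singleton_self x)
  have hinner : ∀ a b : E3, (inner ℝ (S a) (S b) : ℝ) = inner ℝ a b := fun a b => S.inner_map_map a b
  have hxe : (inner ℝ x (S e) : ℝ) = inner ℝ x e := by
    conv_lhs => rw [← hSx]
    exact hinner x e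
  rw [← hS, hxe] at hf
  have h2 := mul_le_mul_of_nonneg_left h hpp.le
  rw [← integral_const_mul, ← integral_sphereMean_comp_isometry S] at h2
  have hI : ∫ η, ‖p‖ * (|A + -B * inner ℝ (S e) (S η)| * ‖S η - p‖⁻¹) ∂sphereMean
      = ∫ η, |A - B * inner ℝ e η| * ‖x - η‖⁻¹ ∂sphereMean := by
    refine integral_congr_ae ?_
    filter_upwards [ae_norm_eq_one] with η hη
    rw [hinner, mul_left_comm, norm_inversePoint_mul_inv hx0 (by rw [S.norm_map, hη])]
    have : ‖x - S η‖ = ‖x - η‖ := by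
      conv_lhs => rw [← hSx, ← map_sub]
      exact S.norm_map _
    rw [this, neg_mul, ← sub_eq_add_neg]
  rw [hI] at h2
  refine le_trans (le_of_eq ?_) h2
  have e1 : ‖p‖ * (‖(0 : E3) - p‖⁻¹ * u (inversionMap p (‖p‖ ^ 2 - 1) 0)) = u x := by
    rw [hp, inversionMap_inversePoint_zero hx0, zero_sub, norm_neg, ← mul_assoc,
      mul_inv_cancel₀ hpp.ne', one_mul]
  rw [mul_add, mul_left_comm, e1, mul_left_comm _ (-B / 3), hf]
  ring

/-! ### Zonal integrals, the radial estimate and second moments -/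

theorem one_add_sq_sub_pos {r t : ℝ} (hr : 0 ≤ r) (hr1 : r < 1) (ht : t ≤ 1) :
    0 < 1 + r ^ 2 - 2 * r * t := by nlinarith

theorem norm_smul_sub_eq_sqrt {r : ℝ} {e η : E3} (he : ‖e‖ = 1) (hη : ‖η‖ = 1) :
    ‖r • e - η‖ = √(1 + r ^ 2 - 2 * r * inner ℝ e η) := by
  rw [← Real.sqrt_sq (norm_nonneg (r • e - η)), norm_sub_sq_real, norm_smul, he, hη,
    real_inner_smul_left]
  congr 1
  rw [mul_one, Real.norm_eq_abs, sq_abs]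
  ring

theorem continuousOn_inv_sqrt_zonal {r : ℝ} (hr : 0 ≤ r) (hr1 : r < 1) :
    ContinuousOn (fun t : ℝ => (√(1 + r ^ 2 - 2 * r * t))⁻¹) (Icc (-1) 1) :=
  ContinuousOn.inv₀ (by fun_prop) fun _ ht =>
    (Real.sqrt_pos.2 (one_add_sq_sub_pos hr hr1 ht.2)).ne'

theorem integral_zonal_mul_inv_norm {r : ℝ} (hr : 0 ≤ r) (hr1 : r < 1) {e : E3} (he : ‖e‖ = 1)
    {g : ℝ → ℝ} (hg : Continuous g) :
    ∫ η, g (inner ℝ e η) * ‖r • e - η‖⁻¹ ∂sphereMean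
      = (∫ t in (-1 : ℝ)..1, g t * (√(1 + r ^ 2 - 2 * r * t))⁻¹) / 2 := by
  rw [← integral_sphereMean_inner he (g := fun t => g t * (√(1 + r ^ 2 - 2 * r * t))⁻¹)
    (hg.continuousOn.mul (continuousOn_inv_sqrt_zonal hr hr1))]
  refine integral_congr_ae ?_
  filter_upwards [ae_norm_eq_one] with η hη
  rw [norm_smul_sub_eq_sqrt he hη]

theorem hasDerivAt_sqrt_zonal {r t : ℝ} (hr : 0 ≤ r) (hr1 : r < 1) (ht : t ≤ 1) :
    HasDerivAt (fun t => √(1 + r ^ 2 - 2 * r * t)) (-(r * (√(1 + r ^ 2 - 2 * r * t))⁻¹)) t := by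
  have h : HasDerivAt (fun t : ℝ => 1 + r ^ 2 - 2 * r * t) (-(2 * r)) t := by
    simpa using ((hasDerivAt_id t).const_mul (2 * r)).const_sub (1 + r ^ 2)
  refine (h.sqrt (one_add_sq_sub_pos hr hr1 ht).ne').congr_deriv ?_
  field_simp

/-- A single primitive of the signed integrand serves on both sides of the sign change at `c`. -/
theorem integral_abs_sub_mul {k Φ : ℝ → ℝ} {c : ℝ} (hc : c ∈ Icc (-1 : ℝ) 1)
    (hk : ContinuousOn k (Icc (-1) 1))
    (hΦ : ∀ t ∈ Icc (-1 : ℝ) 1, HasDerivAt Φ ((t - c) * k t) t) :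
    ∫ t in (-1 : ℝ)..1, |c - t| * k t = Φ (-1) + Φ 1 - 2 * Φ c := by
  have hii : ∀ {f : ℝ → ℝ} {a b : ℝ}, ContinuousOn f (Icc (-1) 1) → a ∈ Icc (-1 : ℝ) 1 →
      b ∈ Icc (-1 : ℝ) 1 → IntervalIntegrable f volume a b := fun hf ha hb =>
    (hf.mono (uIcc_subset_Icc ha hb)).intervalIntegrable
  have hl : (-1 : ℝ) ∈ Icc (-1 : ℝ) 1 := by norm_num
  have hr : (1 : ℝ) ∈ Icc (-1 : ℝ) 1 := by norm_num
  have hf : ContinuousOn (fun t => |c - t| * k t) (Icc (-1) 1) := by fun_prop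
  have hg : ContinuousOn (fun t => (t - c) * k t) (Icc (-1) 1) := by fun_prop
  rw [← intervalIntegral.integral_add_adjacent_intervals (hii hf hl hc) (hii hf hc hr)]
  have h1 : ∫ t in (-1 : ℝ)..c, |c - t| * k t = -(Φ c - Φ (-1)) := by
    rw [← intervalIntegral.integral_eq_sub_of_hasDerivAt
      (fun t ht => hΦ t (uIcc_subset_Icc hl hc ht)) (hii hg hl hc), ← intervalIntegral.integral_neg]
    refine intervalIntegral.integral_congr fun t ht => ?_
    rw [uIcc_of_le hc.1] at ht
    rw [abs_of_nonneg (by linarith [ht.2])]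
    ring
  have h2 : ∫ t in c..1, |c - t| * k t = Φ 1 - Φ c := by
    rw [← intervalIntegral.integral_eq_sub_of_hasDerivAt
      (fun t ht => hΦ t (uIcc_subset_Icc hc hr ht)) (hii hg hc hr)]
    refine intervalIntegral.integral_congr fun t ht => ?_
    rw [uIcc_of_le hc.2] at ht
    rw [abs_of_nonpos (by linarith [ht.1])]
    ring
  rw [h1, h2]
  ring

/-- The threshold `c` is chosen so that `√(1 + r² - 2rc) = 1 - ra`, which makes the integral
rational. For `r > 0` the primitive comes from taking the square root as the new variable; it has
`r²` in the denominator, hence the separate case `r = 0`. -/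
theorem integral_abs_sub_mul_inv_norm {r a : ℝ} (hr : 0 ≤ r) (hr1 : r < 1) (ha : |a| ≤ 1) {e : E3}
    (he : ‖e‖ = 1) :
    ∫ η, |(r + 2 * a - r * a ^ 2) / 2 - inner ℝ e η| * ‖r • e - η‖⁻¹ ∂sphereMean
      = (3 * a ^ 2 + 3 - 2 * r * a ^ 3) / 6 := by
  rw [abs_le] at ha
  set c := (r + 2 * a - r * a ^ 2) / 2 with hc
  have hc1 : c ∈ Icc (-1 : ℝ) 1 := by
    constructor
    · have : 0 ≤ (1 + a) * (2 + r * (1 - a)) :=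
        mul_nonneg (by linarith) (by nlinarith)
      linarith
    · have : 0 ≤ (1 - a) * (2 - r * (1 + a)) :=
        mul_nonneg (by linarith) (by nlinarith)
      linarith
  rw [integral_zonal_mul_inv_norm hr hr1 he (g := fun t => |c - t|) (by fun_prop)]
  rcases hr.eq_or_lt with h0 | h0
  · subst h0
    rw [integral_abs_sub_mul (Φ := fun t => t ^ 2 / 2 - c * t) hc1
      (continuousOn_inv_sqrt_zonal le_rfl zero_lt_one)]
    · simp only [hc]; ring
    · intro t _
      refine (((hasDerivAt_pow 2 t).div_const 2).sub ((hasDerivAt_id t).const_mul c)).congr_deriv ?_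
      simp
  · set σ : ℝ → ℝ := fun t => √(1 + r ^ 2 - 2 * r * t) with hσ
    have hσc : σ c = 1 - r * a := by
      simp only [hσ]
      rw [show 1 + r ^ 2 - 2 * r * c = (1 - r * a) ^ 2 by rw [hc]; ring]
      exact Real.sqrt_sq (by nlinarith)
    have hσ1 : σ 1 = 1 - r := by
      simp only [hσ]
      rw [show 1 + r ^ 2 - 2 * r * 1 = (1 - r) ^ 2 by ring]
      exact Real.sqrt_sq (by linarith)
    have hσm : σ (-1) = 1 + r := by
      simp only [hσ]
      rw [show 1 + r ^ 2 - 2 * r * (-1) = (1 + r) ^ 2 by ring]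
      exact Real.sqrt_sq (by linarith)
    rw [integral_abs_sub_mul (Φ := fun t => -(((1 - r * a) ^ 2 * σ t - σ t ^ 3 / 3) / (2 * r ^ 2))) hc1
      (continuousOn_inv_sqrt_zonal hr hr1)]
    · simp only [hσc, hσ1, hσm]
      field_simp
      ring
    · intro t ht
      have hd := hasDerivAt_sqrt_zonal hr hr1 ht.2
      refine (((hd.const_mul ((1 - r * a) ^ 2)).sub ((hd.pow 3).div_const 3)).div_const
        (2 * r ^ 2)).neg.congr_deriv ?_
      have hpos := one_add_sq_sub_pos hr hr1 ht.2
      have hs : √(1 + r ^ 2 - 2 * r * t) ^ 2 = 1 + r ^ 2 - 2 * r * t := Real.sq_sqrt hpos.le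
      have hs0 : √(1 + r ^ 2 - 2 * r * t) ≠ 0 := (Real.sqrt_pos.2 hpos).ne'
      push_cast
      rw [hs, hc]
      field_simp
      ring

theorem integral_sq_mul_inv_norm_zonal {r : ℝ} (hr : 0 < r) (hr1 : r < 1) {e : E3} (he : ‖e‖ = 1) :
    ∫ η, (inner ℝ e η) ^ 2 * ‖r • e - η‖⁻¹ ∂sphereMean = 1 / 3 + 2 * r ^ 2 / 15 := by
  rw [integral_zonal_mul_inv_norm hr.le hr1 he (g := fun t => t ^ 2) (by fun_prop)]
  set σ : ℝ → ℝ := fun t => √(1 + r ^ 2 - 2 * r * t) with hσ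
  have hσ1 : σ 1 = 1 - r := by
    simp only [hσ]
    rw [show 1 + r ^ 2 - 2 * r * 1 = (1 - r) ^ 2 by ring]
    exact Real.sqrt_sq (by linarith)
  have hσm : σ (-1) = 1 + r := by
    simp only [hσ]
    rw [show 1 + r ^ 2 - 2 * r * (-1) = (1 + r) ^ 2 by ring]
    exact Real.sqrt_sq (by linarith)
  have hI : uIcc (-1 : ℝ) 1 = Icc (-1) 1 := uIcc_of_le (by norm_num)
  rw [intervalIntegral.integral_eq_sub_of_hasDerivAt (f := fun t => -(((1 + r ^ 2) ^ 2 * σ t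
    - 2 * (1 + r ^ 2) * (σ t ^ 3 / 3) + σ t ^ 5 / 5) / (4 * r ^ 3)))]
  · simp only [hσ1, hσm]
    field_simp
    ring
  · intro t ht
    rw [hI] at ht
    have hd := hasDerivAt_sqrt_zonal hr.le hr1 ht.2
    refine ((((hd.const_mul ((1 + r ^ 2) ^ 2)).sub (((hd.pow 3).div_const 3).const_mul
      (2 * (1 + r ^ 2)))).add ((hd.pow 5).div_const 5)).div_const (4 * r ^ 3)).neg.congr_deriv ?_
    have hpos := one_add_sq_sub_pos hr.le hr1 ht.2
    have hs : √(1 + r ^ 2 - 2 * r * t) ^ 2 = 1 + r ^ 2 - 2 * r * t := Real.sq_sqrt hpos.le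
    have hs0 : √(1 + r ^ 2 - 2 * r * t) ≠ 0 := (Real.sqrt_pos.2 hpos).ne'
    push_cast
    rw [show √(1 + r ^ 2 - 2 * r * t) ^ 4 = (√(1 + r ^ 2 - 2 * r * t) ^ 2) ^ 2 by ring, hs]
    field_simp
    ring
  · refine ContinuousOn.intervalIntegrable ?_
    rw [hI]
    exact ContinuousOn.mul (by fun_prop) (continuousOn_inv_sqrt_zonal hr.le hr1)

theorem integrable_mul_inv_norm {x : E3} (hx : ‖x‖ < 1) {g : E3 → ℝ} (hg : Continuous g) :
    Integrable (fun η => g η * ‖x - η‖⁻¹) sphereMean := by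
  refine integrable_sphereMean (hg.continuousOn.mul (ContinuousOn.inv₀ (by fun_prop) fun η hη => ?_))
  rw [mem_sphere_zero_iff_norm] at hη
  rw [norm_ne_zero_iff, sub_ne_zero]
  rintro rfl
  linarith

/-- The upper radial estimate, in the direction `e` at `r • e`. -/
theorem radial_fderiv_le {u : E3 → ℝ} (hu : HarmonicOnNhd u (ball 0 1))
    (hb : ∀ y ∈ ball (0 : E3) 1, |u y| ≤ 1) {x e : E3} (hx : ‖x‖ < 1) (he : ‖e‖ = 1)
    (hxe : x = ‖x‖ • e) :
    (1 - ‖x‖ ^ 2) * fderiv ℝ u x e ≤ (3 - ‖x‖ * u x) * ((1 - u x ^ 2) / 2) := by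
  set r := ‖x‖ with hr
  set a := u x with ha
  -- This `A` is the height at which the function equal to `1` below and `-1` above has mean `a`
  -- against the weight `|x - η|⁻¹`, so it is adapted to the value `u x = a`.
  have h := affine_le_integral_abs hu hb hx e ((r + 2 * a - r * a ^ 2) / 2) 1
  have h2 := integral_abs_sub_mul_inv_norm (norm_nonneg x) hx (hb x (by simpa using hx)) he
  rw [← hr, ← ha, ← hxe] at h2
  simp only [one_mul] at h
  rw [h2, ← hr, ← ha] at h
  have h3 : (inner ℝ x e : ℝ) = r := by
    rw [hxe, real_inner_smul_left, real_inner_self_eq_norm_sq, he]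
    simp
  rw [h3] at h
  linarith

/-- The second moments of the weight `‖x - η‖⁻¹` on the sphere. -/
theorem integral_inner_sq_mul_inv_norm_le {x e : E3} (hx : ‖x‖ < 1) (he : ‖e‖ = 1) :
    ∫ η, (inner ℝ e η) ^ 2 * ‖x - η‖⁻¹ ∂sphereMean ≤ 1 / 3 + 2 * (inner ℝ x e) ^ 2 / 15 := by
  by_cases hx0 : x = 0
  · subst hx0
    rw [integral_congr_ae (g := fun η => (inner ℝ e η) ^ 2), integral_sphereMean_inner_sq he]
    · simp
    · filter_upwards [ae_norm_eq_one] with η hη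
      simp [hη]
  have hr : 0 < ‖x‖ := norm_pos_iff.2 hx0
  have hf1 : ‖‖x‖⁻¹ • x‖ = 1 := by rw [norm_smul, norm_inv, norm_norm, inv_mul_cancel₀ hr.ne']
  obtain ⟨b, hb⟩ := Orthonormal.exists_orthonormalBasis_extension_of_card_eq (𝕜 := ℝ) (E := E3)
    (ι := Fin 3) (by simp) (v := fun _ => ‖x‖⁻¹ • x) (s := {0})
    (by
      rw [orthonormal_iff_ite]
      rintro ⟨i, hi⟩ ⟨j, hj⟩
      simp only [mem_singleton_iff] at hi hj
      subst hi hj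
      simpa using Or.inl hf1)
  have hb0 : b 0 = ‖x‖⁻¹ • x := hb 0 (mem_singleton 0)
  have hxb : x = ‖x‖ • b 0 := by rw [hb0, smul_smul, mul_inv_cancel₀ hr.ne', one_smul]
  set M : Fin 3 → Fin 3 → ℝ := fun i j =>
    ∫ η, (inner ℝ (b i) η * inner ℝ (b j) η) * ‖x - η‖⁻¹ ∂sphereMean with hM
  have hinv : ∀ T : E3 ≃ₗᵢ[ℝ] E3, T x = x → ∀ v w : E3,
      ∫ η, (inner ℝ (T v) η * inner ℝ (T w) η) * ‖x - η‖⁻¹ ∂sphereMean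
        = ∫ η, (inner ℝ v η * inner ℝ w η) * ‖x - η‖⁻¹ ∂sphereMean := by
    intro T hT v w
    rw [← integral_sphereMean_comp_isometry T]
    congr 1
    funext η
    rw [T.inner_map_map, T.inner_map_map]
    congr 2
    conv_lhs => rw [← hT, ← map_sub, T.norm_map]
  -- The weight is symmetric about the axis `ℝx`. Reflecting `b j` kills the off-diagonal moments,
  -- and exchanging the other two axes makes their moments equal. The axial moment and the total
  -- mass `1` then determine `M`.
  have hoff : ∀ i j, i ≠ j → j ≠ 0 → M i j = 0 := by
    intro i j hij hj
    set T : E3 ≃ₗᵢ[ℝ] E3 := (ℝ ∙ b j)ᗮ.reflection with hT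
    have hfix : ∀ k, k ≠ j → T (b k) = b k := fun k hk =>
      Submodule.reflection_mem_subspace_eq_self (Submodule.mem_orthogonal_singleton_iff_inner_right.2
        (by rw [b.inner_eq_ite, if_neg hk.symm]))
    have hneg : T (b j) = -b j := Submodule.reflection_orthogonalComplement_singleton_eq_neg (b j)
    have := hinv T (by conv_lhs => rw [hxb, map_smul, hfix 0 hj.symm, ← hxb]) (b i) (b j)
    rw [hfix i hij, hneg] at this
    simp only [inner_neg_left, mul_neg, neg_mul, integral_neg] at this
    simp only [hM]
    linarith
  have h12 : M 1 1 = M 2 2 := by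
    have hfix := OrthonormalBasis.equiv_apply_basis b b (Equiv.swap (1 : Fin 3) 2)
    have := hinv (b.equiv b (Equiv.swap (1 : Fin 3) 2))
      (by conv_lhs => rw [hxb, map_smul, hfix 0, Equiv.swap_apply_of_ne_of_ne (by decide) (by decide),
        ← hxb]) (b 2) (b 2)
    rw [hfix 2, Equiv.swap_apply_right] at this
    exact this
  have hMi : ∀ i j, Integrable (fun η => (inner ℝ (b i) η * inner ℝ (b j) η) * ‖x - η‖⁻¹) sphereMean :=
    fun i j => integrable_mul_inv_norm hx (by fun_prop)
  have hsum : M 0 0 + M 1 1 + M 2 2 = 1 := by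
    rw [← Fin.sum_univ_three fun i => M i i, ← (integral_inv_norm_sub_aux hx).1,
      ← integral_finsetSum _ fun i _ => hMi i i]
    refine integral_congr_ae ?_
    filter_upwards [ae_norm_eq_one] with η hη
    have h := b.sum_sq_norm_inner_right η
    rw [Fin.sum_univ_three, hη] at h
    rw [Fin.sum_univ_three]
    simp only [Real.norm_eq_abs, sq_abs] at h
    linear_combination ‖x - η‖⁻¹ * h
  have h00 : M 0 0 = 1 / 3 + 2 * ‖x‖ ^ 2 / 15 := by
    have h := integral_sq_mul_inv_norm_zonal hr hx hf1
    rw [← hb0, ← hxb] at h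
    rw [← h]
    simp only [hM, sq]
  set c : Fin 3 → ℝ := fun i => inner ℝ (b i) e with hc
  have hec : ∀ η, (inner ℝ e η : ℝ) = c 0 * inner ℝ (b 0) η + c 1 * inner ℝ (b 1) η
      + c 2 * inner ℝ (b 2) η := by
    intro η
    rw [← b.sum_inner_mul_inner e η, Fin.sum_univ_three]
    simp only [hc, real_inner_comm e]
  have hcc : c 0 ^ 2 + c 1 ^ 2 + c 2 ^ 2 = 1 := by
    have h := b.sum_sq_norm_inner_right e
    rw [Fin.sum_univ_three, he] at h
    simpa only [Real.norm_eq_abs, sq_abs, one_pow] using h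
  have hmain : ∫ η, (inner ℝ e η) ^ 2 * ‖x - η‖⁻¹ ∂sphereMean
      = ∑ i, ∑ j, c i * c j * M i j := by
    have hpt : ∀ η, (inner ℝ e η) ^ 2 * ‖x - η‖⁻¹ = ∑ i, ∑ j, c i * c j *
        ((inner ℝ (b i) η * inner ℝ (b j) η) * ‖x - η‖⁻¹) := by
      intro η
      rw [hec]
      simp only [Fin.sum_univ_three]
      ring
    simp only [hpt]
    rw [integral_finsetSum _ fun i _ => integrable_finsetSum _ fun j _ => (hMi i j).const_mul _]
    refine Finset.sum_congr rfl fun i _ => ?_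
    rw [integral_finsetSum _ fun j _ => (hMi i j).const_mul _]
    simp only [hM, integral_const_mul]
  have hsymm : ∀ i j, M i j = M j i := fun i j => by simp only [hM, mul_comm (inner ℝ (b i) _ : ℝ)]
  simp only [Fin.sum_univ_three] at hmain
  rw [hmain, hoff 0 1 (by decide) (by decide), hoff 0 2 (by decide) (by decide),
    hoff 1 2 (by decide) (by decide), hsymm 1 0, hsymm 2 0, hsymm 2 1,
    hoff 0 1 (by decide) (by decide), hoff 0 2 (by decide) (by decide),
    hoff 1 2 (by decide) (by decide)]
  have h11 : M 1 1 = (1 - M 0 0) / 2 := by linarith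
  have h22 : M 2 2 = (1 - M 0 0) / 2 := by linarith
  have hxe : (inner ℝ x e : ℝ) = ‖x‖ * c 0 := by
    conv_lhs => rw [hxb, real_inner_smul_left]
  have h1 : c 1 ^ 2 + c 2 ^ 2 = 1 - c 0 ^ 2 := by linarith
  have h2 : c 0 ^ 2 ≤ 1 := by nlinarith [sq_nonneg (c 1), sq_nonneg (c 2)]
  rw [h11, h22, h00, hxe]
  -- The exact value differs from the bound by `-|x|²(1 - c₀²)/15`, which is discarded.
  have h3 : 0 ≤ ‖x‖ ^ 2 * (1 - c 0 ^ 2) := mul_nonneg (sq_nonneg _) (by linarith)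
  have h4 : c 1 ^ 2 * ((1 - (1 / 3 + 2 * ‖x‖ ^ 2 / 15)) / 2)
      + c 2 ^ 2 * ((1 - (1 / 3 + 2 * ‖x‖ ^ 2 / 15)) / 2)
      = (1 - c 0 ^ 2) * ((1 - (1 / 3 + 2 * ‖x‖ ^ 2 / 15)) / 2) := by rw [← add_mul, h1]
  nlinarith [h3, h4]

/-! ### First absolute moments and the gradient estimate -/

/-- With `d = 4 - l` and `t = 1 + ⟨x,e⟩`, this is the inequality `8(d - t)² ≤ d²(12 - d - 5t)` to
which the tail bound for `⟨x,e⟩ < 0` reduces. The limit `14/5` corresponds to `l ≥ 6/5`. -/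
theorem tail_polynomial_nonneg {d t : ℝ} (hd0 : 0 < d) (hd : d ≤ 14 / 5) (ht0 : 0 ≤ t) (ht1 : t ≤ 1)
    (htd : t ≤ d) : 0 ≤ d ^ 2 * (4 - d) + 16 * d * t - 5 * d ^ 2 * t - 8 * t ^ 2 := by
  rcases le_total 1 d with h | h
  · have h1 : 0 ≤ -d ^ 3 - d ^ 2 + 16 * d - 8 := by
      have h2 : 0 ≤ (d - 1) * (14 / 5 - d) * (d + 1) :=
        mul_nonneg (mul_nonneg (by linarith) (by linarith)) (by linarith)
      nlinarith
    have h3 : 0 ≤ (1 - t) * (d ^ 2 * (4 - d)) :=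
      mul_nonneg (by linarith) (mul_nonneg (sq_nonneg d) (by linarith))
    have h4 : 0 ≤ t * (-d ^ 3 - d ^ 2 + 16 * d - 8) := mul_nonneg ht0 h1
    have h5 : 0 ≤ t * (1 - t) := mul_nonneg ht0 (by linarith)
    nlinarith
  · have h1 : 0 ≤ d ^ 2 * (4 - d) := mul_nonneg (sq_nonneg d) (by linarith)
    have h2 : 0 ≤ d * t * (3 - 3 * d) := mul_nonneg (by positivity) (by linarith)
    have h3 : t ^ 2 ≤ d * t := by nlinarith
    have h4 : d ^ 2 * t ≤ d * t := by nlinarith [mul_nonneg hd0.le ht0]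
    nlinarith [mul_nonneg hd0.le ht0]

/-- On `[c, 1]` the integrand `(t - c)/(t - s)` is concave and lies below its tangent at the
midpoint, whose integral is the length times the midpoint value. The `max t c` in the denominator
keeps the integrand continuous on the whole line. -/
theorem tail_integral_le {c s : ℝ} (hc : -1 ≤ c) (hc1 : c ≤ 1) (hsc : s < c) :
    ∫ t in (-1 : ℝ)..1, max (t - c) 0 / (max t c - s) ≤ (1 - c) ^ 2 / (1 + c - 2 * s) := by
  have hcont : Continuous fun t : ℝ => max (t - c) 0 / (max t c - s) :=
    Continuous.div (by fun_prop) (by fun_prop) fun t => by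
      have : c ≤ max t c := le_max_right _ _
      linarith
  have hn : 0 < 1 + c - 2 * s := by linarith
  rw [← intervalIntegral.integral_add_adjacent_intervals (hcont.intervalIntegrable (-1) c)
    (hcont.intervalIntegrable c 1)]
  have h0 : ∫ t in (-1 : ℝ)..c, max (t - c) 0 / (max t c - s) = 0 := by
    refine (intervalIntegral.integral_congr (g := fun _ => (0 : ℝ)) fun t ht => ?_).trans
      intervalIntegral.integral_zero
    rw [uIcc_of_le hc] at ht
    simp only
    rw [max_eq_right (by linarith [ht.2]), zero_div]
  rw [h0, zero_add]
  have hle : ∫ t in c..1, max (t - c) 0 / (max t c - s)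
      ≤ ∫ t in c..1, ((1 - c) / (1 + c - 2 * s) +
        4 * (c - s) / (1 + c - 2 * s) ^ 2 * (t - (1 + c) / 2)) := by
    refine intervalIntegral.integral_mono_on hc1 (hcont.intervalIntegrable _ _)
      (Continuous.intervalIntegrable (by fun_prop) _ _) fun t ht => ?_
    rw [max_eq_left (by linarith [ht.1]), max_eq_left ht.1, div_le_iff₀ (by linarith [ht.1])]
    have hkey : ((1 - c) / (1 + c - 2 * s) + 4 * (c - s) / (1 + c - 2 * s) ^ 2 * (t - (1 + c) / 2))
        * (t - s) - (t - c) = (c - s) * (2 * t - 1 - c) ^ 2 / (1 + c - 2 * s) ^ 2 := by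
      field_simp
      ring
    have : 0 ≤ (c - s) * (2 * t - 1 - c) ^ 2 / (1 + c - 2 * s) ^ 2 := by
      have : 0 < c - s := by linarith
      positivity
    linarith
  refine hle.trans (le_of_eq ?_)
  rw [intervalIntegral.integral_add (Continuous.intervalIntegrable (by fun_prop) _ _)
    (Continuous.intervalIntegrable (by fun_prop) _ _), intervalIntegral.integral_const_mul,
    intervalIntegral.integral_sub (Continuous.intervalIntegrable (by fun_prop) _ _)
    (Continuous.intervalIntegrable (by fun_prop) _ _), integral_id]
  simp only [intervalIntegral.integral_const, smul_eq_mul]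
  field_simp
  ring

section GradientEstimate

variable {x e : E3}

theorem integral_quadratic_mul_inv_norm (hx : ‖x‖ < 1) (p q s : ℝ) :
    ∫ η, (p * (inner ℝ e η) ^ 2 + q * inner ℝ e η + s) * ‖x - η‖⁻¹ ∂sphereMean
      = p * (∫ η, (inner ℝ e η) ^ 2 * ‖x - η‖⁻¹ ∂sphereMean) + q * (inner ℝ x e / 3) + s := by
  have h2 : Integrable (fun η => (inner ℝ e η) ^ 2 * ‖x - η‖⁻¹) sphereMean :=
    integrable_mul_inv_norm hx (by fun_prop)
  have h1 : Integrable (fun η => inner ℝ e η * ‖x - η‖⁻¹) sphereMean :=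
    integrable_mul_inv_norm hx (by fun_prop)
  have h0 : Integrable (fun η => ‖x - η‖⁻¹) sphereMean := by
    simpa using integrable_mul_inv_norm hx (g := fun _ => 1) continuous_const
  have hpt : ∀ η, (p * (inner ℝ e η) ^ 2 + q * inner ℝ e η + s) * ‖x - η‖⁻¹
      = p * ((inner ℝ e η) ^ 2 * ‖x - η‖⁻¹) + q * (inner ℝ e η * ‖x - η‖⁻¹) + s * ‖x - η‖⁻¹ :=
    fun η => by ring
  have h21 : Integrable (fun η => p * ((inner ℝ e η) ^ 2 * ‖x - η‖⁻¹)
    + q * (inner ℝ e η * ‖x - η‖⁻¹)) sphereMean := (h2.const_mul p).add (h1.const_mul q)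
  simp only [hpt]
  rw [integral_add h21 (h0.const_mul s), integral_add (h2.const_mul p) (h1.const_mul q),
    integral_const_mul, integral_const_mul, integral_const_mul, (integral_inv_norm_sub_aux hx).1,
    (integral_inv_norm_sub_aux hx).2, mul_one]

/-- With `M` the desired bound, `|f| ≤ (f² + M²)/(2M)` reduces the claim to second moments. These
give at most `16/5 + l²` for the mean of `f²`, and this is at most `M²` when `l ≤ 6/5`. -/
theorem integral_abs_le_of_small (hx : ‖x‖ < 1) (he : ‖e‖ = 1) {l : ℝ} (hl0 : 0 ≤ l) (hl : l ≤ 6 / 5) :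
    ∫ η, |l + inner ℝ x e - 3 * inner ℝ e η| * ‖x - η‖⁻¹ ∂sphereMean ≤ (16 + l ^ 2) / 8 := by
  set ρ : ℝ := inner ℝ x e with hρ
  have hρ1 : ρ ^ 2 ≤ 1 := by
    have h := abs_real_inner_le_norm x e
    rw [he, mul_one, ← hρ] at h
    rw [sq_le_one_iff_abs_le_one]
    linarith
  set M : ℝ := (16 + l ^ 2) / 8 with hM
  have hM0 : 0 < M := by positivity
  have hle : ∫ η, |l + ρ - 3 * inner ℝ e η| * ‖x - η‖⁻¹ ∂sphereMean
      ≤ ∫ η, (9 / (2 * M) * (inner ℝ e η) ^ 2 + -(6 * (l + ρ) / (2 * M)) * inner ℝ e η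
        + ((l + ρ) ^ 2 + M ^ 2) / (2 * M)) * ‖x - η‖⁻¹ ∂sphereMean := by
    refine integral_mono (integrable_mul_inv_norm hx (by fun_prop))
      (integrable_mul_inv_norm hx (by fun_prop)) fun η => ?_
    refine mul_le_mul_of_nonneg_right ?_ (by positivity)
    rw [show 9 / (2 * M) * (inner ℝ e η) ^ 2 + -(6 * (l + ρ) / (2 * M)) * inner ℝ e η
        + ((l + ρ) ^ 2 + M ^ 2) / (2 * M) = ((l + ρ - 3 * inner ℝ e η) ^ 2 + M ^ 2) / (2 * M) by ring,
      le_div_iff₀ (by positivity), ← sq_abs (l + ρ - 3 * inner ℝ e η)]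
    nlinarith [sq_nonneg (|l + ρ - 3 * inner ℝ e η| - M)]
  refine hle.trans ?_
  rw [integral_quadratic_mul_inv_norm hx]
  have hsm := integral_inner_sq_mul_inv_norm_le hx he
  rw [← hρ] at hsm ⊢
  set Q := ∫ η, (inner ℝ e η) ^ 2 * ‖x - η‖⁻¹ ∂sphereMean
  rw [show 9 / (2 * M) * Q + -(6 * (l + ρ) / (2 * M)) * (ρ / 3) + ((l + ρ) ^ 2 + M ^ 2) / (2 * M)
    = (9 * Q - ρ ^ 2 + l ^ 2 + M ^ 2) / (2 * M) by ring, div_le_iff₀ (by positivity)]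
  have hM2 : 16 / 5 + l ^ 2 ≤ M ^ 2 := by
    have h2 : l ^ 2 ≤ 36 / 25 := by nlinarith
    rw [hM]
    nlinarith [sq_nonneg l]
  nlinarith

/-- Reduction of the first absolute moment to a bound for the positive part. -/
theorem integral_abs_le_of_posPart_le (hx : ‖x‖ < 1) {l C : ℝ}
    (h : ∫ η, max (3 * inner ℝ e η - inner ℝ x e - l) 0 * ‖x - η‖⁻¹ ∂sphereMean ≤ C) :
    ∫ η, |l + inner ℝ x e - 3 * inner ℝ e η| * ‖x - η‖⁻¹ ∂sphereMean ≤ 2 * C + l := by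
  have hpt : ∀ η : E3, |l + inner ℝ x e - 3 * inner ℝ e η| * ‖x - η‖⁻¹
      = 2 * (max (3 * inner ℝ e η - inner ℝ x e - l) 0 * ‖x - η‖⁻¹)
        + (0 * (inner ℝ e η) ^ 2 + -3 * inner ℝ e η + (l + inner ℝ x e)) * ‖x - η‖⁻¹ := by
    intro η
    rcases le_total (3 * inner ℝ e η - inner ℝ x e - l) 0 with h0 | h0
    · rw [max_eq_right h0, abs_of_nonneg (by linarith)]; ring
    · rw [max_eq_left h0, abs_of_nonpos (by linarith)]; ring
  simp only [hpt]
  rw [integral_add ((integrable_mul_inv_norm hx (by fun_prop)).const_mul 2)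
    (integrable_mul_inv_norm hx (by fun_prop)), integral_const_mul,
    integral_quadratic_mul_inv_norm hx]
  linarith

/-- The positive part is dominated on `t ≤ 1` by the parabola `β(3t + 1)²/16`, which takes the value
`β` at `t = 1`; this needs `β ≤ 2`. Its mean is at most `β(1 + ρ)/4`, and if `β > 0` then `β + (1 +
ρ) = 4 - l`, so the arithmetic-geometric mean inequality finishes. -/
theorem integral_abs_le_of_inner_nonneg (hx : ‖x‖ < 1) (he : ‖e‖ = 1) {l : ℝ} (hl : 6 / 5 ≤ l)
    (hρ0 : 0 ≤ (inner ℝ x e : ℝ)) :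
    ∫ η, |l + inner ℝ x e - 3 * inner ℝ e η| * ‖x - η‖⁻¹ ∂sphereMean ≤ (16 + l ^ 2) / 8 := by
  set ρ : ℝ := inner ℝ x e with hρ
  have hρ1 : ρ ≤ 1 := by
    have h := real_inner_le_norm x e
    rw [he, mul_one, ← hρ] at h
    linarith
  set β := max (3 - ρ - l) 0 with hβ
  have hβ0 : 0 ≤ β := le_max_right _ _
  have hle : ∫ η, max (3 * inner ℝ e η - ρ - l) 0 * ‖x - η‖⁻¹ ∂sphereMean
      ≤ ∫ η, (9 * β / 16 * (inner ℝ e η) ^ 2 + 6 * β / 16 * inner ℝ e η + β / 16) * ‖x - η‖⁻¹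
        ∂sphereMean := by
    refine integral_mono_ae (integrable_mul_inv_norm hx (by fun_prop))
      (integrable_mul_inv_norm hx (by fun_prop)) ?_
    filter_upwards [ae_norm_eq_one] with η hη
    have ht : (inner ℝ e η : ℝ) ≤ 1 := by
      have h := real_inner_le_norm e η
      rwa [he, hη, one_mul] at h
    refine mul_le_mul_of_nonneg_right ?_ (by positivity)
    set t : ℝ := inner ℝ e η
    rw [show 9 * β / 16 * t ^ 2 + 6 * β / 16 * t + β / 16 = β * (3 * t + 1) ^ 2 / 16 by ring]
    refine max_le ?_ (by positivity)
    have h1 : 3 - ρ - l ≤ β := le_max_left _ _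
    have h2 : β ≤ 2 := max_le (by linarith) (by norm_num)
    have h3 : β * (3 * t + 1) ^ 2 / 16 - (β - 3 * (1 - t))
        = 3 * (1 - t) * (1 - β / 2) + 9 * β * (1 - t) ^ 2 / 16 := by ring
    have h4 : 0 ≤ 3 * (1 - t) * (1 - β / 2) := mul_nonneg (by linarith) (by linarith)
    have h5 : 0 ≤ 9 * β * (1 - t) ^ 2 / 16 := by positivity
    linarith
  rw [integral_quadratic_mul_inv_norm hx] at hle
  have hsm := integral_inner_sq_mul_inv_norm_le hx he
  rw [← hρ] at hsm hle
  refine (integral_abs_le_of_posPart_le hx hle).trans ?_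
  set Q := ∫ η, (inner ℝ e η) ^ 2 * ‖x - η‖⁻¹ ∂sphereMean
  have h1 : 9 * β / 16 * Q + 6 * β / 16 * (ρ / 3) + β / 16 ≤ β * (1 + ρ) / 4 := by
    have h2 : 9 * Q + 2 * ρ + 1 ≤ 4 * (1 + ρ) := by nlinarith
    have h3 := mul_le_mul_of_nonneg_left h2 hβ0
    linarith
  have h4 : 4 * (β * (1 + ρ)) ≤ (4 - l) ^ 2 := by
    rcases le_total (3 - ρ - l) 0 with h | h
    · rw [hβ, max_eq_right h]; nlinarith [sq_nonneg (4 - l)]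
    · rw [hβ, max_eq_left h]; nlinarith [sq_nonneg (3 - ρ - l - (1 + ρ))]
  nlinarith

/-- Projection to the axis `e` gives `|x - η| ≥ ⟨e,η⟩ - ⟨x,e⟩`, which is positive where the positive
part is nonzero. The integrand becomes zonal, and Archimedes' theorem reduces it to the tail
integral. -/
theorem integral_abs_le_of_inner_neg (hx : ‖x‖ < 1) (he : ‖e‖ = 1) {l : ℝ} (hl : 6 / 5 ≤ l)
    (hl4 : l < 4) (hρ0 : (inner ℝ x e : ℝ) < 0) :
    ∫ η, |l + inner ℝ x e - 3 * inner ℝ e η| * ‖x - η‖⁻¹ ∂sphereMean ≤ (16 + l ^ 2) / 8 := by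
  set ρ : ℝ := inner ℝ x e with hρ
  have hρ1 : -1 ≤ ρ := by
    have h := neg_le_of_abs_le (abs_real_inner_le_norm x e)
    rw [he, mul_one, ← hρ] at h
    linarith
  set c := (l + ρ) / 3 with hc
  have hcρ : ρ < c := by rw [hc]; linarith
  have hcont : Continuous fun t : ℝ => max (t - c) 0 / (max t c - ρ) :=
    Continuous.div (by fun_prop) (by fun_prop) fun t => by
      have : c ≤ max t c := le_max_right _ _
      linarith
  have hle : ∫ η, max (3 * inner ℝ e η - ρ - l) 0 * ‖x - η‖⁻¹ ∂sphereMean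
      ≤ ∫ η, 3 * (max (inner ℝ e η - c) 0 / (max (inner ℝ e η) c - ρ)) ∂sphereMean := by
    refine integral_mono (integrable_mul_inv_norm hx (by fun_prop))
      (integrable_sphereMean (Continuous.continuousOn
        ((hcont.comp (by fun_prop : Continuous fun η : E3 => (inner ℝ e η : ℝ))).const_mul 3)))
      fun η => ?_
    simp only
    rcases le_total (inner ℝ e η : ℝ) c with h | h
    · rw [max_eq_right (by linarith), max_eq_right (by linarith)]
      simp
    · rw [max_eq_left (by linarith), max_eq_left (by linarith), max_eq_left h,
        show 3 * (inner ℝ e η : ℝ) - ρ - l = 3 * (inner ℝ e η - c) by rw [hc]; ring, mul_assoc,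
        div_eq_mul_inv]
      have hpos : 0 < (inner ℝ e η : ℝ) - ρ := by linarith
      have hn : (inner ℝ e η : ℝ) - ρ ≤ ‖x - η‖ := by
        have h1 := real_inner_le_norm e (η - x)
        rw [he, one_mul, inner_sub_right, real_inner_comm x e, norm_sub_rev] at h1
        exact h1
      have : ‖x - η‖⁻¹ ≤ ((inner ℝ e η : ℝ) - ρ)⁻¹ := inv_anti₀ hpos hn
      have h0 : 0 ≤ (inner ℝ e η : ℝ) - c := by linarith
      gcongr
  rw [integral_const_mul, integral_sphereMean_inner he hcont.continuousOn] at hle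
  refine (integral_abs_le_of_posPart_le hx hle).trans ?_
  rcases le_total c 1 with h1 | h1
  · have ht := tail_integral_le (by rw [hc]; linarith) h1 hcρ
    have hpoly := tail_polynomial_nonneg (d := 4 - l) (t := 1 + ρ) (by linarith) (by linarith)
      (by linarith) (by linarith) (by linarith)
    have hden : 0 < 1 + c - 2 * ρ := by linarith
    have hq : (1 - c) ^ 2 / (1 + c - 2 * ρ) ≤ (4 - l) ^ 2 / 24 := by
      rw [div_le_iff₀ hden, hc]
      nlinarith
    linarith
  · have h0 : ∫ t in (-1 : ℝ)..1, max (t - c) 0 / (max t c - ρ) = 0 := by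
      refine (intervalIntegral.integral_congr (g := fun _ => (0 : ℝ)) fun t ht => ?_).trans
        intervalIntegral.integral_zero
      rw [uIcc_of_le (by norm_num)] at ht
      simp only
      rw [max_eq_right (by linarith [ht.2]), zero_div]
    rw [h0]
    nlinarith [sq_nonneg (4 - l)]

theorem integral_abs_le_of_nonneg (hx : ‖x‖ < 1) (he : ‖e‖ = 1) {l : ℝ} (hl0 : 0 ≤ l) (hl4 : l < 4) :
    ∫ η, |l + inner ℝ x e - 3 * inner ℝ e η| * ‖x - η‖⁻¹ ∂sphereMean ≤ (16 + l ^ 2) / 8 := by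
  rcases le_total l (6 / 5) with h | h
  · exact integral_abs_le_of_small hx he hl0 h
  · rcases le_or_gt 0 (inner ℝ x e : ℝ) with h1 | h1
    · exact integral_abs_le_of_inner_nonneg hx he h h1
    · exact integral_abs_le_of_inner_neg hx he h hl4 h1

/-- Both sides are unchanged under `(l, e) ↦ (-l, -e)`, so `l ≥ 0` may be assumed. -/
theorem integral_abs_le (hx : ‖x‖ < 1) (he : ‖e‖ = 1) {l : ℝ} (hl : |l| < 4) :
    ∫ η, |l + inner ℝ x e - 3 * inner ℝ e η| * ‖x - η‖⁻¹ ∂sphereMean ≤ (16 + l ^ 2) / 8 := by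
  rcases le_total 0 l with h | h
  · exact integral_abs_le_of_nonneg hx he h (by rwa [abs_of_nonneg h] at hl)
  · have h1 := integral_abs_le_of_nonneg hx (e := -e) (by rwa [norm_neg]) (l := -l) (by linarith)
      (by rwa [abs_of_nonpos h] at hl)
    rw [neg_sq] at h1
    refine le_trans (le_of_eq ?_) h1
    congr 1
    funext η
    rw [inner_neg_right, inner_neg_left, ← abs_neg]
    congr 2
    ring

/-- The estimate of every directional derivative. -/
theorem directional_fderiv_le {u : E3 → ℝ} (hu : HarmonicOnNhd u (ball 0 1))
    (hb : ∀ y ∈ ball (0 : E3) 1, |u y| < 1) (hx : ‖x‖ < 1) (he : ‖e‖ = 1) :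
    (1 - ‖x‖ ^ 2) * fderiv ℝ u x e ≤ 2 * (1 - u x ^ 2) := by
  have hux := hb x (by simpa using hx)
  -- The summand `⟨x,e⟩` in `A` cancels the term `-⟨x,e⟩ u(x)`. With `l = 4u(x)` the remaining
  -- inequality is `4u² + (1 - |x|²) ∂ₑu ≤ 2 + 2u²`.
  have h := affine_le_integral_abs hu (fun y hy => (hb y hy).le) hx e (4 * u x + inner ℝ x e) 3
  have h2 := integral_abs_le hx he (l := 4 * u x) (by rw [abs_mul, abs_of_pos (by norm_num)]; linarith)
  have := h.trans h2
  linarith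

end GradientEstimate

theorem norm_gradient_le {u : E3 → ℝ} (hu : HarmonicOnNhd u (ball 0 1))
    (hb : ∀ y ∈ ball (0 : E3) 1, |u y| < 1) {x : E3} (hx : ‖x‖ < 1) :
    ‖gradient u x‖ ≤ 2 * ((1 - u x ^ 2) / (1 - ‖x‖ ^ 2)) := by
  have hpos : 0 < 1 - ‖x‖ ^ 2 := by nlinarith [norm_nonneg x]
  have hux := hb x (by simpa using hx)
  have h1 : 0 ≤ 1 - u x ^ 2 := by
    have := (sq_lt_one_iff_abs_lt_one _).2 hux
    linarith
  by_cases hg : gradient u x = 0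
  · rw [hg, norm_zero]
    positivity
  have hn : ‖gradient u x‖ ≠ 0 := norm_ne_zero_iff.2 hg
  have h := directional_fderiv_le hu hb hx (e := ‖gradient u x‖⁻¹ • gradient u x)
    (by rw [norm_smul, norm_inv, norm_norm, inv_mul_cancel₀ hn])
  have h2 : fderiv ℝ u x (‖gradient u x‖⁻¹ • gradient u x) = ‖gradient u x‖ := by
    have h3 : fderiv ℝ u x (gradient u x) = inner ℝ (gradient u x) (gradient u x) := by
      conv_rhs => rw [gradient, InnerProductSpace.toDual_symm_apply]
      rfl
    rw [map_smul, h3, real_inner_self_eq_norm_sq, smul_eq_mul]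
    field_simp
  rw [h2] at h
  rw [mul_div_assoc', le_div_iff₀ hpos]
  linarith

/-! ### Hyperbolic length and the main theorem -/

section HyperbolicLength

variable {E F : Type*} [NormedAddCommGroup E] [InnerProductSpace ℝ E]
  [NormedAddCommGroup F] [InnerProductSpace ℝ F]

theorem IsBallCurve.intervalIntegrable {γ : ℝ → E} {x y : E} (h : IsBallCurve γ x y) :
    IntervalIntegrable (fun t => 2 * ‖derivWithin γ (Icc 0 1) t‖ / (1 - ‖γ t‖ ^ 2)) volume 0 1 := by
  refine ContinuousOn.intervalIntegrable ?_
  rw [uIcc_of_le zero_le_one]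
  have hd := h.contDiffOn.continuousOn_derivWithin (uniqueDiffOn_Icc zero_lt_one) le_rfl
  refine (continuousOn_const.mul hd.norm).div
    (continuousOn_const.sub (h.contDiffOn.continuousOn.norm.pow 2)) fun t ht => ?_
  have := h.mem_ball t ht
  rw [mem_ball_zero_iff] at this
  nlinarith [norm_nonneg (γ t)]

theorem hyperbolicLength_nonneg {γ : ℝ → E} {x y : E} (h : IsBallCurve γ x y) :
    0 ≤ hyperbolicLength γ := by
  refine intervalIntegral.integral_nonneg zero_le_one fun t ht => ?_
  have := h.mem_ball t ht
  rw [mem_ball_zero_iff] at this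
  have h1 : 0 ≤ 1 - ‖γ t‖ ^ 2 := by nlinarith [norm_nonneg (γ t)]
  positivity

theorem exists_isBallCurve {x y : E} (hx : x ∈ ball (0 : E) 1) (hy : y ∈ ball (0 : E) 1) :
    ∃ γ : ℝ → E, IsBallCurve γ x y := by
  refine ⟨fun t => AffineMap.lineMap x y t, ?_, fun t ht => ?_, by simp, by simp⟩
  · simp only [AffineMap.lineMap_apply, vsub_eq_sub, vadd_eq_add]
    fun_prop
  · exact (convex_ball (0 : E) 1).lineMap_mem hx hy ht

/-- A map that multiplies hyperbolic lengths of curves by at most `K` multiplies hyperbolic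
distances by at most `K`. -/
theorem hyperbolicDist_le_mul {K : ℝ} (hK : 0 < K) {x y : E} {x' y' : F} {f : E → F}
    (hx : x ∈ ball (0 : E) 1) (hy : y ∈ ball (0 : E) 1)
    (hf : ∀ γ : ℝ → E, IsBallCurve γ x y →
      IsBallCurve (f ∘ γ) x' y' ∧ hyperbolicLength (f ∘ γ) ≤ K * hyperbolicLength γ) :
    hyperbolicDist x' y' ≤ K * hyperbolicDist x y := by
  rw [← div_le_iff₀' hK]
  obtain ⟨γ₀, hγ₀⟩ := exists_isBallCurve hx hy
  refine le_csInf ⟨_, γ₀, hγ₀, rfl⟩ ?_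
  rintro L ⟨γ, hγ, rfl⟩
  rw [div_le_iff₀' hK]
  refine le_trans (csInf_le ⟨0, ?_⟩ ⟨f ∘ γ, (hf γ hγ).1, rfl⟩) (hf γ hγ).2
  rintro L ⟨δ, hδ, rfl⟩
  exact hyperbolicLength_nonneg hδ

/-- The bound `hK` compares infinitesimal metrics; the chain rule turns it into a pointwise
comparison of the two length integrands. -/
theorem IsBallCurve.comp_of_fderiv_le {K : ℝ} {γ : ℝ → E} {x y : E} (hγ : IsBallCurve γ x y)
    {f : E → F} (hf : ContDiffOn ℝ 1 f (ball 0 1)) (hmaps : MapsTo f (ball 0 1) (ball 0 1))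
    (hK : ∀ z ∈ ball (0 : E) 1, ∀ v, ‖fderiv ℝ f z v‖ / (1 - ‖f z‖ ^ 2) ≤ K * (‖v‖ / (1 - ‖z‖ ^ 2))) :
    IsBallCurve (f ∘ γ) (f x) (f y) ∧ hyperbolicLength (f ∘ γ) ≤ K * hyperbolicLength γ := by
  have hc : IsBallCurve (f ∘ γ) (f x) (f y) :=
    ⟨hf.comp hγ.contDiffOn hγ.mem_ball, fun t ht => hmaps (hγ.mem_ball t ht),
      congrArg f hγ.source, congrArg f hγ.target⟩
  refine ⟨hc, ?_⟩
  rw [hyperbolicLength, hyperbolicLength, ← intervalIntegral.integral_const_mul]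
  refine intervalIntegral.integral_mono_on zero_le_one hc.intervalIntegrable
    (hγ.intervalIntegrable.const_mul K) fun t ht => ?_
  have hz := hγ.mem_ball t ht
  have hd : derivWithin (f ∘ γ) (Icc 0 1) t = fderiv ℝ f (γ t) (derivWithin γ (Icc 0 1) t) := by
    have h1 : HasFDerivAt f (fderiv ℝ f (γ t)) (γ t) :=
      ((hf.contDiffAt (isOpen_ball.mem_nhds hz)).differentiableAt one_ne_zero).hasFDerivAt
    have h2 := (hγ.contDiffOn.differentiableOn one_ne_zero t ht).hasDerivWithinAt
    exact (h1.comp_hasDerivWithinAt t h2).derivWithin (uniqueDiffOn_Icc zero_lt_one t ht)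
  rw [hd, Function.comp_apply, mul_div_assoc, mul_div_assoc, mul_left_comm]
  exact mul_le_mul_of_nonneg_left (hK _ hz _) zero_le_two

end HyperbolicLength

end

theorem mainTheorem7 (u : EuclideanSpace ℝ (Fin 3) → ℝ)
    (hu : HarmonicOnNhd u (ball (0 : EuclideanSpace ℝ (Fin 3)) 1))
    (hmaps : ∀ x ∈ ball (0 : EuclideanSpace ℝ (Fin 3)) 1, u x ∈ Ioo (-1 : ℝ) 1) :
    -- the radial derivative: `e` is the unit vector `x / |x|`, and any unit vector if `x = 0`
    (∀ x ∈ ball (0 : EuclideanSpace ℝ (Fin 3)) 1, ∀ e : EuclideanSpace ℝ (Fin 3),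
      ‖e‖ = 1 → x = ‖x‖ • e →
        (-3 - ‖x‖ * u x) / (1 - ‖x‖ ^ 2) * ((1 - u x ^ 2) / 2) ≤ fderiv ℝ u x e ∧
        fderiv ℝ u x e ≤ (3 - ‖x‖ * u x) / (1 - ‖x‖ ^ 2) * ((1 - u x ^ 2) / 2)) ∧
    (∀ x ∈ ball (0 : EuclideanSpace ℝ (Fin 3)) 1,
      ‖gradient u x‖ ≤ 2 * ((1 - u x ^ 2) / (1 - ‖x‖ ^ 2))) ∧
    -- hyperbolic distance of the values, in the interval `(-1, 1)` and in the unit disc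
    (∀ x₁ ∈ ball (0 : EuclideanSpace ℝ (Fin 3)) 1,
      ∀ x₂ ∈ ball (0 : EuclideanSpace ℝ (Fin 3)) 1,
        hyperbolicDist (u x₁) (u x₂) ≤ 2 * hyperbolicDist x₁ x₂ ∧
        hyperbolicDist (!₂[u x₁, 0] : EuclideanSpace ℝ (Fin 2)) !₂[u x₂, 0] ≤
          2 * hyperbolicDist x₁ x₂) := by
  have habs : ∀ y ∈ ball (0 : E3) 1, |u y| < 1 := fun y hy => abs_lt.2 (hmaps y hy)
  have hden : ∀ y ∈ ball (0 : E3) 1, 0 < 1 - ‖y‖ ^ 2 := fun y hy => by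
    rw [mem_ball_zero_iff] at hy
    nlinarith [norm_nonneg y]
  have hgrad : ∀ x ∈ ball (0 : E3) 1, ‖gradient u x‖ ≤ 2 * ((1 - u x ^ 2) / (1 - ‖x‖ ^ 2)) :=
    fun x hx => norm_gradient_le hu habs (by simpa using hx)
  refine ⟨fun x hx e he hxe => ?_, hgrad, fun x₁ h₁ x₂ h₂ => ?_⟩
  · have hx1 : ‖x‖ < 1 := by simpa using hx
    have hpos := hden x hx
    have hup := radial_fderiv_le hu (fun y hy => (habs y hy).le) hx1 he hxe
    -- The lower radial bound is the upper one for `-u`.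
    have hlow := radial_fderiv_le hu.neg
      (fun y hy => by rw [Pi.neg_apply, abs_neg]; exact (habs y hy).le) hx1 he hxe
    rw [fderiv_neg, neg_apply, Pi.neg_apply, neg_sq] at hlow
    rw [div_mul_eq_mul_div, div_mul_eq_mul_div, div_le_iff₀ hpos, le_div_iff₀ hpos]
    constructor <;> linarith
  have hspeed : ∀ z ∈ ball (0 : E3) 1, ∀ v, ‖fderiv ℝ u z v‖ / (1 - ‖u z‖ ^ 2)
      ≤ 2 * (‖v‖ / (1 - ‖z‖ ^ 2)) := by
    intro z hz v
    have h1 : 0 < 1 - u z ^ 2 := sub_pos.2 ((sq_lt_one_iff_abs_lt_one _).2 (habs z hz))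
    rw [Real.norm_eq_abs (u z), sq_abs, div_le_iff₀ h1]
    have h2 : ‖fderiv ℝ u z v‖ ≤ ‖gradient u z‖ * ‖v‖ := by
      rw [gradient, LinearIsometryEquiv.norm_map]
      exact (fderiv ℝ u z).le_opNorm v
    refine h2.trans ((mul_le_mul_of_nonneg_right (hgrad z hz) (norm_nonneg v)).trans (le_of_eq ?_))
    ring
  have hu1 : ContDiffOn ℝ 1 u (ball 0 1) := hu.contDiffOn.of_le one_le_two
  have hum : MapsTo u (ball 0 1) (ball 0 1) := fun y hy => by
    rw [mem_ball_zero_iff, Real.norm_eq_abs]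
    exact habs y hy
  -- The interval embeds in the disc by a linear isometry, so the speed bound for `u` carries over
  -- unchanged to `ι ∘ u`.
  let ι : ℝ →L[ℝ] EuclideanSpace ℝ (Fin 2) :=
    ContinuousLinearMap.toSpanSingleton ℝ (EuclideanSpace.single 0 1)
  have hιn : ∀ t, ‖ι t‖ = ‖t‖ := fun t => by simp [ι, norm_smul]
  have hι : ∀ t, ι t = !₂[t, 0] := fun t => by
    ext i
    fin_cases i <;> simp [ι]
  refine ⟨hyperbolicDist_le_mul two_pos h₁ h₂ fun γ hγ => hγ.comp_of_fderiv_le hu1 hum hspeed, ?_⟩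
  rw [← hι, ← hι]
  refine hyperbolicDist_le_mul (f := fun y => ι (u y)) two_pos h₁ h₂ fun γ hγ =>
    hγ.comp_of_fderiv_le (f := fun y => ι (u y)) (ι.contDiff.comp_contDiffOn hu1)
      (fun y hy => ?_) fun z hz v => ?_
  · have := hum hy
    rw [mem_ball_zero_iff] at this ⊢
    rwa [hιn]
  · have hd : DifferentiableAt ℝ u z :=
      (hu1.contDiffAt (isOpen_ball.mem_nhds hz)).differentiableAt one_ne_zero
    have : fderiv ℝ (fun y => ι (u y)) z v = ι (fderiv ℝ u z v) := by
      have h : HasFDerivAt (fun y => ι (u y)) (ι.comp (fderiv ℝ u z)) z :=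
        ι.hasFDerivAt.comp z hd.hasFDerivAt
      rw [h.fderiv, ContinuousLinearMap.comp_apply]
    rw [this, hιn, hιn]
    exact hspeed z hz v
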